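/- Let $A\in\mathbb{Z}^{d\times d}$ and $\boldsymbol b\in\mathbb{Z}^d$, and suppose that $A$ is non-degenerate, i.e. no quotient of two distinct nonzero complex eigenvalues of $A$ is a root of unity. Consider the loop "while $\boldsymbol b^T\boldsymbol x\ge 0$ do $\boldsymbol x\leftarrow A\boldsymbol x$". Let $$\mathit{NT}=\{\boldsymbol u\in\mathbb{R}^d:\ \boldsymbol b^TA^n\boldsymbol u\ge 0\text{ for all } n\in\mathbb{N}\},\qquad \mathit{ENT}=\{\boldsymbol u\in\mathbb{R}^d:\ A^n\boldsymbol u\in\mathit{NT}\text{ for some } n\in\mathbb{N}\}.$$ Partition the set of complex eigenvalues of $A$ into the classes $S_1,\dots,S_m$ of eigenvalues of equal modulus, and let $V_i\subseteq\mathbb{R}^d$ be the real subspace of all real vectors lying in the sum of the generalised eigenspaces (in $\mathbb{C}^d$) of $A$ for the eigenvalues in $S_i$. Let $i\in\{1,\dots,m\}$ and suppose that at least one of the following holds: 1. $d\le 5$; 2. $S_i$ contains no positive real number; 3. every non-real eigenvalue in $S_i$ is simple, i.e. has multiplicity one as a root of the minimal polynomial of $A$. Then the set $\mathit{ENT}_i=\mathit{ENT}\cap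 V_i$ is semi-algebraic, that is, a Boolean combination of sets of the form $\{\boldsymbol x\in\mathbb{R}^d: p(\boldsymbol x)\ge 0\}$, where $p$ is a polynomial with integer coefficients. -/

import Mathlib

namespace LinearLoop

/-- Points from which every iterate of the loop body `f` satisfies the loop guard `P`. -/
def NT {X : Type*} (f : X → X) (P : Set X) : Set X :=
  {u | ∀ n : ℕ, f^[n] u ∈ P}

/-- Eventually non-terminating points: some iterate of `f` (disregarding the guard) lands in `NT`. -/
def ENT {X : Type*} (f : X → X) (P : Set X) : Set X :=
  {u | ∃ n : ℕ, f^[n] u ∈ NT f P}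

/-- Loop body `x ← A x` of a homogeneous linear loop, acting on real vectors. -/
def body {d : ℕ} (A : Matrix (Fin d) (Fin d) ℤ) : (Fin d → ℝ) → (Fin d → ℝ) :=
  fun x => (A.map (fun a : ℤ => (a : ℝ))).mulVec x

/-- Loop guard `bᵀ x ≥ 0`. -/
def guard {d : ℕ} (b : Fin d → ℤ) : Set (Fin d → ℝ) :=
  {x | 0 ≤ ∑ j, (b j : ℝ) * x j}

/-- The subsets of `ℝᵈ` that are Boolean combinations of sets `{x | p x ≥ 0}`, where `p` is a
polynomial with integer coefficients. -/
inductive IsSemialgebraic {d : ℕ} : Set (Fin d → ℝ) → Prop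
  | basic (p : MvPolynomial (Fin d) ℤ) : IsSemialgebraic {x | 0 ≤ MvPolynomial.aeval x p}
  | compl (s : Set (Fin d → ℝ)) : IsSemialgebraic s → IsSemialgebraic sᶜ
  | union (s t : Set (Fin d → ℝ)) :
      IsSemialgebraic s → IsSemialgebraic t → IsSemialgebraic (s ∪ t)
  | inter (s t : Set (Fin d → ℝ)) :
      IsSemialgebraic s → IsSemialgebraic t → IsSemialgebraic (s ∩ t)

/-- The matrix `A` with entries regarded as complex numbers. -/
def complexMatrix {d : ℕ} (A : Matrix (Fin d) (Fin d) ℤ) : Matrix (Fin d) (Fin d) ℂ :=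
  A.map (fun a : ℤ => (a : ℂ))

/-- The set of complex eigenvalues (real ones included) of `A`. -/
def eigenvalues {d : ℕ} (A : Matrix (Fin d) (Fin d) ℤ) : Set ℂ :=
  {z | Module.End.HasEigenvalue (Matrix.toLin' (complexMatrix A)) z}

/-- No quotient of two distinct eigenvalues is a root of unity. (An eigenvalue `0` never violates
this: quotients with numerator or denominator `0` are `0` here.) -/
def NonDegenerate {d : ℕ} (A : Matrix (Fin d) (Fin d) ℤ) : Prop :=
  ∀ z ∈ eigenvalues A, ∀ w ∈ eigenvalues A, z ≠ w → ∀ k : ℕ, 0 < k → (z / w) ^ k ≠ 1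

/-- The index of `z`: its multiplicity as a root of the minimal polynomial of `A`. -/
noncomputable def index {d : ℕ} (A : Matrix (Fin d) (Fin d) ℤ) (z : ℂ) : ℕ :=
  (minpoly ℂ (complexMatrix A)).rootMultiplicity z

/-- The set of moduli of the eigenvalues of `A`; it indexes the modulus classes. -/
def eigenvalueModuli {d : ℕ} (A : Matrix (Fin d) (Fin d) ℤ) : Set ℝ :=
  {r | ∃ z ∈ eigenvalues A, ‖z‖ = r}

/-- The class of all eigenvalues of `A` of modulus `r`. -/
def modulusClass {d : ℕ} (A : Matrix (Fin d) (Fin d) ℤ) (r : ℝ) : Set ℂ :=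
  {z | z ∈ eigenvalues A ∧ ‖z‖ = r}

/-- The inclusion of `ℝᵈ` in `ℂᵈ`. -/
noncomputable def realToComplex (d : ℕ) : (Fin d → ℝ) →ₗ[ℝ] (Fin d → ℂ) :=
  Complex.ofRealCLM.toLinearMap.compLeft (Fin d)

/-- The real subspace of `ℝᵈ` belonging to the eigenvalues of modulus `r`: the real vectors in the
sum of the (complex) generalised eigenspaces of `A` for the eigenvalues of modulus `r`. -/
noncomputable def modulusSubspace {d : ℕ} (A : Matrix (Fin d) (Fin d) ℤ) (r : ℝ) :
    Submodule ℝ (Fin d → ℝ) :=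
  ((⨆ z ∈ modulusClass A r,
    Module.End.maxGenEigenspace (Matrix.toLin' (complexMatrix A)) z).restrictScalars ℝ).comap
      (realToComplex d)

end LinearLoop

namespace Semialgebraic

open Polynomial Filter Topology

/-! ### Finite families of polynomials closed under pseudo-remainders -/

/-! Membership in `ENT` means that the guard values along the orbit are eventually nonnegative
(`mem_ENT_iff`). For `r = 0` the matrix acts nilpotently on the subspace, so every point qualifies.
For `r > 0`, split a point of the subspace into generalised eigenvectors and divide the `n`-th guard
value by `r ^ n`. The result is a sum of terms `c i k * (n.choose k) * ζ i ^ n` with distinct `ζ i`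
on the unit circle (`guardForm_pow_eq`).

Each of the three hypotheses, together with non-degeneracy, forces either `r` or all other
eigenvalues of modulus `r` to have index at most one (`index_le_one_or`). Hence for `k > 0` the
coefficient of `n.choose k` is either a constant or a combination of `ζ i ^ n` with no constant
term. Let `k` be the largest level with a nonzero coefficient. If `k > 0`, a combination without
constant term has mean zero and is not eventually nonnegative, so the leading coefficient has to be
a positive constant. If no level above 0 survives, the sequence is a linear form evaluated along an
orbit in a torus. By recurrence and Kronecker's theorem it is eventually nonnegative exactly when
the form is nonnegative on the subgroup cut out by the multiplicative relations among the `ζ i`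
(`eventually_nonneg_iff`). These relations are finitely generated and polynomial in real and
imaginary parts.

The criterion is therefore a first-order formula over the reals with algebraic constants, and
quantifier elimination finishes the proof. Elimination is carried out for sets whose membership
depends only on the signs of finitely many integer polynomials (`SignDetermined`). The one-variable
step, `exists_finite_sign_determining`, closes a finite family of polynomials under derivatives,
pseudo-remainders and removal of leading terms. When the leading coefficients have equal signs at
two parameter values, it matches the two real lines in a sign-preserving, essentially monotone way,
adding polynomials in order of degree. -/

theorem exists_pseudo_remainder {R : Type*} [CommRing R] (g : R[X]) (hg : 0 < g.natDegree)
    (f : R[X]) : ∃ (k : ℕ) (q r : R[X]), r.natDegree < g.natDegree ∧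
      C (g.leadingCoeff ^ k) * f = q * g + r := by
  induction hn : f.natDegree using Nat.strong_induction_on generalizing f with
  | _ n ih =>
    subst hn
    by_cases hfg : f.natDegree < g.natDegree
    · exact ⟨0, 0, f, hfg, by simp⟩
    · push Not at hfg
      obtain ⟨k, q, r, hr, h⟩ := ih _
        (natDegree_cancelLeads_lt_of_natDegree_le_natDegree hfg (hg.trans_le hfg)) _ rfl
      refine ⟨k + 1, q + C (g.leadingCoeff ^ k) * C f.leadingCoeff *
        X ^ (f.natDegree - g.natDegree), r, hr, ?_⟩
      have : (q + C (g.leadingCoeff ^ k) * C f.leadingCoeff *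
          X ^ (f.natDegree - g.natDegree)) * g + r = (q * g + r) +
          C (g.leadingCoeff ^ k) * C f.leadingCoeff * X ^ (f.natDegree - g.natDegree) * g := by
        ring
      rw [this, ← h, cancelLeads, Nat.sub_eq_zero_of_le hfg, pow_zero, mul_one, pow_succ, C_mul]
      ring

/-- The even exponent makes the multiplier positive wherever the leading coefficient does not
vanish. At a root of `g`, the remainder then has the same sign as `f`, whatever the sign of that
coefficient. -/
theorem exists_pseudo_remainder_even {R : Type*} [CommRing R] (f g : R[X]) :
    ∃ r : R[X], 0 < g.natDegree → r.natDegree < g.natDegree ∧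
      ∃ (k : ℕ) (q : R[X]), C (g.leadingCoeff ^ (2 * k)) * f = q * g + r := by
  by_cases hg : 0 < g.natDegree
  · obtain ⟨k, q, r, hr, h⟩ := exists_pseudo_remainder g hg f
    refine ⟨C (g.leadingCoeff ^ k) * r, fun _ =>
      ⟨(natDegree_C_mul_le _ _).trans_lt hr, k, C (g.leadingCoeff ^ k) * q, ?_⟩⟩
    rw [two_mul, pow_add, C_mul, mul_assoc, h]
    ring
  · exact ⟨0, fun h => absurd h hg⟩

/-- A pseudo-remainder of `f` modulo `g`, computed with an even power of the leading coefficient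
of `g`. -/
noncomputable def pseudoRem {R : Type*} [CommRing R] (f g : R[X]) : R[X] :=
  (exists_pseudo_remainder_even f g).choose

theorem pseudoRem_spec {R : Type*} [CommRing R] (f g : R[X]) (hg : 0 < g.natDegree) :
    (pseudoRem f g).natDegree < g.natDegree ∧
      ∃ (k : ℕ) (q : R[X]), C (g.leadingCoeff ^ (2 * k)) * f = q * g + pseudoRem f g :=
  (exists_pseudo_remainder_even f g).choose_spec hg

/-- Process the divisors `g` by decreasing degree. Outputs have smaller degree than `g`, so those
added at one level create no new pairs at that level or above; the restriction `deg g ≤ deg f` is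
what excludes them as first arguments too. -/
theorem exists_finite_closure {α : Type*} (deg : α → ℕ) (O : α → α → Set α)
    (hfin : ∀ f g, (O f g).Finite) (hdeg : ∀ f g, 0 < deg g → ∀ h ∈ O f g, deg h < deg g)
    (F : Set α) (hF : F.Finite) :
    ∃ E : Set α, F ⊆ E ∧ E.Finite ∧
      ∀ f ∈ E, ∀ g ∈ E, 0 < deg g → deg g ≤ deg f → O f g ⊆ E := by
  obtain ⟨N, hN⟩ := (hF.image deg).bddAbove
  have key : ∀ j m, m + j = N → ∃ E : Set α, F ⊆ E ∧ E.Finite ∧ (∀ f ∈ E, deg f ≤ N) ∧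
      ∀ f ∈ E, ∀ g ∈ E, m < deg g → deg g ≤ deg f → O f g ⊆ E := by
    intro j
    induction j with
    | zero =>
      rintro m rfl
      have hN' : ∀ f ∈ F, deg f ≤ m := fun f hf => hN ⟨f, hf, rfl⟩
      exact ⟨F, subset_rfl, hF, hN', fun f _ g hg h _ => absurd (hN' g hg) (not_le.2 h)⟩
    | succ j ih =>
      intro m hm
      obtain ⟨E, hFE, hE, hEN, hcl⟩ := ih (m + 1) (by omega)
      refine ⟨E ∪ ⋃ f ∈ E, ⋃ g ∈ {g ∈ E | m < deg g ∧ deg g ≤ deg f}, O f g,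
        hFE.trans Set.subset_union_left,
        hE.union (hE.biUnion fun f _ => (hE.subset (Set.sep_subset _ _)).biUnion
          fun g _ => hfin f g), ?_, ?_⟩
      · rintro f (hf | hf)
        · exact hEN f hf
        · simp only [Set.mem_iUnion] at hf
          obtain ⟨f', hf', g, ⟨hg, hgm, hgf⟩, h⟩ := hf
          exact ((hdeg f' g (by omega) f h).le).trans (hEN g hg)
      · have hnew : ∀ h ∈ E ∪ ⋃ f ∈ E, ⋃ g ∈ {g ∈ E | m < deg g ∧ deg g ≤ deg f}, O f g,
            h ∈ E ∨ deg h ≤ m := by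
          rintro h (hh | hh)
          · exact Or.inl hh
          · simp only [Set.mem_iUnion] at hh
            obtain ⟨f', hf', g, ⟨hg, hgm, hgf⟩, hh⟩ := hh
            -- Only divisors of degree exactly `m + 1` contribute anything new, and what they
            -- contribute has degree at most `m`.
            by_cases h1 : m + 1 < deg g
            · exact Or.inl (hcl f' hf' g hg h1 hgf hh)
            · have := hdeg f' g (by omega) h hh
              exact Or.inr (by omega)
        intro f hf g hg hgm hgf h hh
        have hg' := (hnew g hg).resolve_right (by omega)
        have hf' := (hnew f hf).resolve_right (by omega)
        refine Or.inr ?_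
        simp only [Set.mem_iUnion]
        exact ⟨f, hf', g, ⟨hg', hgm, hgf⟩, hh⟩
  obtain ⟨E, h1, h2, -, h3⟩ := key N 0 (by simp)
  exact ⟨E, h1, h2, h3⟩

/-! ### Correspondences between two real lines -/

/-- A relation between two copies of the real line that is total on both sides, induces a bijection
between classes of points, and is monotone on these classes. -/
structure IsCorrespondence (Φ : ℝ → ℝ → Prop) : Prop where
  total_left : ∀ y, ∃ y', Φ y y'
  total_right : ∀ y', ∃ y, Φ y y'
  difunctional : ∀ {a b c e}, Φ a b → Φ c b → Φ c e → Φ a e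
  mono : ∀ {a b a' b'}, a < b → Φ a a' → Φ b b' → b' ≤ a' → Φ a b'

namespace IsCorrespondence

variable {Φ : ℝ → ℝ → Prop}

theorem symm (h : IsCorrespondence Φ) : IsCorrespondence fun y' y => Φ y y' where
  total_left := h.total_right
  total_right := h.total_left
  difunctional h1 h2 h3 := h.difunctional h3 h2 h1
  mono {a b a' b'} hab h1 h2 hle := by
    rcases hle.lt_or_eq with hlt | rfl
    · exact h.mono hlt h2 h1 hab.le
    · exact h1

theorem neg (h : IsCorrespondence Φ) : IsCorrespondence fun y y' => Φ (-y) (-y') where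
  total_left y := by
    obtain ⟨y', hy⟩ := h.total_left (-y)
    exact ⟨-y', by simpa using hy⟩
  total_right y := by
    obtain ⟨y', hy⟩ := h.total_right (-y)
    exact ⟨-y', by simpa using hy⟩
  difunctional h1 h2 h3 := h.difunctional h1 h2 h3
  mono {a b a' b'} hab h1 h2 hle := by
    have h3 : Φ (-b) (-a') := h.mono (neg_lt_neg hab) h2 h1 (neg_le_neg hle)
    exact h.difunctional h1 h3 h2

theorem between (h : IsCorrespondence Φ) {a t b y' : ℝ} (hat : a < t) (htb : t < b)
    (ha : Φ a y') (hb : Φ b y') : Φ t y' := by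
  obtain ⟨t', ht⟩ := h.total_left t
  rcases le_total t' y' with hle | hle
  · exact h.difunctional ht (h.mono hat ha ht hle) ha
  · exact h.mono htb ht hb hle

theorem between_right (h : IsCorrespondence Φ) {a t b y : ℝ} (hat : a < t) (htb : t < b)
    (ha : Φ y a) (hb : Φ y b) : Φ y t :=
  h.symm.between hat htb ha hb

/-- An increasing polynomial that is positive somewhere on an open class stays positive up to the
right end of that class. The partners of this endpoint transfer the sign to the other line. If the
other class is unbounded above, positivity there comes from a nonconstant increasing polynomial
being unbounded. -/
theorem exists_pos (h : IsCorrespondence Φ) (p p' : ℝ[X]) {y y' : ℝ} (hy : Φ y y')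
    (hdich : ∀ e e', Φ e e' →
      ({t | Φ t e'}.Finite ∧ SignType.sign (p.eval e) = SignType.sign (p'.eval e')) ∨
      {t' | Φ e t'} ∈ 𝓝 e')
    (hC' : ∀ t', Φ y t' → {t' | Φ y t'} ∈ 𝓝 t')
    (hd : ∀ t, Φ t y' → 0 < p.derivative.eval t)
    (hd' : ∀ t', Φ y t' → 0 < p'.derivative.eval t')
    (hpos : ∃ t, Φ t y' ∧ 0 < p.eval t) : ∃ t', Φ y t' ∧ 0 < p'.eval t' := by
  obtain ⟨t, ht, hpt⟩ := hpos
  by_contra! hneg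
  set C' : Set ℝ := {t' | Φ y t'} with hC'def
  have hy' : y' ∈ C' := hy
  have hderiv : ∀ (q : ℝ[X]) (s : ℝ), deriv (fun x => q.eval x) s = q.derivative.eval s :=
    fun q s => q.deriv
  have hbdd : BddAbove C' := by
    by_contra hb
    rw [not_bddAbove_iff] at hb
    have hall : ∀ s, y' ≤ s → Φ y s := by
      intro s hs
      rcases hs.eq_or_lt with rfl | hs
      · exact hy
      · obtain ⟨b, hb, hsb⟩ := hb s
        exact h.between_right hs hsb hy hb
    have hmono : MonotoneOn (fun x => p'.eval x) (Set.Ici y') := by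
      refine monotoneOn_of_deriv_nonneg (convex_Ici _) p'.continuous.continuousOn
        p'.differentiable.differentiableOn fun s hs => ?_
      rw [hderiv]
      exact (hd' s (hall s (interior_subset hs))).le
    have hbd : IsBoundedUnder (· ≤ ·) atTop fun x => |p'.eval x| := by
      refine ⟨|p'.eval y'|, ?_⟩
      rw [eventually_map]
      filter_upwards [eventually_ge_atTop y'] with s hs
      have h1 := hmono Set.self_mem_Ici hs hs
      have h2 := hneg s (hall s hs)
      have h3 := hneg y' hy
      simp only at h1
      rw [abs_of_nonpos h2, abs_of_nonpos h3]
      linarith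
    have hdeg := (Polynomial.isBoundedUnder_abs_atTop_iff _).1 hbd
    rw [eq_C_of_degree_le_zero hdeg] at hd'
    simpa using hd' y' hy
  set e' := sSup C' with he'def
  have hlub : IsLUB C' e' := isLUB_csSup ⟨y', hy'⟩ hbdd
  have he'C : e' ∉ C' := by
    intro he
    obtain ⟨ε, hε, hball⟩ := Metric.mem_nhds_iff.1 (hC' e' he)
    have := hlub.1 (hball (show e' + ε / 2 ∈ Metric.ball e' ε by
      simp [abs_of_pos, hε]))
    linarith
  obtain ⟨e, he⟩ := h.total_right e'
  -- The supremum `e'` is a limit of the class without belonging to it, so its own class is not a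
  -- neighbourhood of it and the first alternative of `hdich` must hold.
  have hfin : {t | Φ t e'}.Finite ∧
      SignType.sign (p.eval e) = SignType.sign (p'.eval e') := by
    refine (hdich e e' he).resolve_right fun hn => he'C ?_
    have hcl : e' ∈ closure C' := hlub.mem_closure ⟨y', hy'⟩
    obtain ⟨s, hs, hsC⟩ := mem_closure_iff_nhds.1 hcl _ hn
    exact h.difunctional hsC hs he
  have hp'e : p'.eval e' ≤ 0 := by
    have hcl : e' ∈ closure C' := hlub.mem_closure ⟨y', hy'⟩
    exact closure_minimal (fun s hs => hneg s hs)
      (isClosed_le p'.continuous continuous_const) hcl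
  have hpe : p.eval e ≤ 0 := by
    by_contra! hcon
    rw [sign_pos hcon, eq_comm, sign_eq_one_iff] at hfin
    linarith [hfin.2]
  have hye' : y' < e' := lt_of_le_of_ne (hlub.1 hy') fun hh => he'C (hh ▸ hy')
  have hnot : ∀ m, Φ m y' → m ≠ e := by
    rintro m hm rfl
    exact he'C (h.difunctional hy hm he)
  have hte : t < e := by
    refine lt_of_le_of_ne ?_ (hnot t ht)
    by_contra! hlt
    exact hnot e (h.mono hlt he ht hye'.le) rfl
  have hinc : ∀ m, t < m → m < e → ¬ Φ m y' → Φ m e' := by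
    intro m htm hme hm
    obtain ⟨m', hm'⟩ := h.total_left m
    have hm'C : m' ∉ C' := fun hh => hm (h.difunctional hm' hh hy)
    refine h.mono hme hm' he ?_
    refine hlub.2 fun s hs => ?_
    by_contra! hlt
    have h1 : Φ t s := h.difunctional ht hy hs
    exact hm (h.difunctional (h.difunctional hm' (h.mono htm h1 hm' hlt.le) h1) h1 ht)
  -- A point outside the class would drag a whole interval up to `e` into the class of `e'`, which
  -- is finite.
  have hinC : ∀ m, t < m → m < e → Φ m y' := by
    intro m htm hme
    by_contra hm
    have : Set.Ioo m e ⊆ {t | Φ t e'} := by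
      intro m₁ hm₁
      refine hinc m₁ (htm.trans hm₁.1) hm₁.2 fun hh => hm ?_
      exact h.between htm hm₁.1 ht hh
    exact (Set.Ioo_infinite hme) (hfin.1.subset this)
  have hmono : MonotoneOn (fun x => p.eval x) (Set.Icc t e) := by
    refine monotoneOn_of_deriv_nonneg (convex_Icc _ _) p.continuous.continuousOn
      p.differentiable.differentiableOn fun s hs => ?_
    rw [interior_Icc] at hs
    rw [hderiv]
    exact (hd s (hinC s hs.1 hs.2)).le
  have := hmono (Set.left_mem_Icc.2 hte.le) (Set.right_mem_Icc.2 hte.le) hte.le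
  simp only at this
  linarith

theorem convex_class (h : IsCorrespondence Φ) (y' : ℝ) : Convex ℝ {t | Φ t y'} := by
  refine Set.OrdConnected.convex ⟨fun a ha b hb t ht => ?_⟩
  rcases ht.1.eq_or_lt with rfl | hat
  · exact ha
  rcases ht.2.eq_or_lt with rfl | htb
  · exact hb
  exact h.between hat htb ha hb

/-- Replacing each `q` by `-q(-X)` and reflecting both lines keeps derivatives positive and swaps
the signs of values, which reduces this to `exists_pos`. -/
theorem exists_neg (h : IsCorrespondence Φ) (p p' : ℝ[X]) {y y' : ℝ} (hy : Φ y y')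
    (hdich : ∀ e e', Φ e e' →
      ({t | Φ t e'}.Finite ∧ SignType.sign (p.eval e) = SignType.sign (p'.eval e')) ∨
      {t' | Φ e t'} ∈ 𝓝 e')
    (hC' : ∀ t', Φ y t' → {t' | Φ y t'} ∈ 𝓝 t')
    (hd : ∀ t, Φ t y' → 0 < p.derivative.eval t)
    (hd' : ∀ t', Φ y t' → 0 < p'.derivative.eval t')
    (hneg : ∃ t, Φ t y' ∧ p.eval t < 0) : ∃ t', Φ y t' ∧ p'.eval t' < 0 := by
  have hder : ∀ (q : ℝ[X]) (t : ℝ), (-(q.comp (-X))).derivative.eval t =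
      q.derivative.eval (-t) := fun q t => by simp [derivative_comp]
  have hev : ∀ (q : ℝ[X]) (t : ℝ), (-(q.comp (-X))).eval t = -q.eval (-t) := fun q t => by simp
  have hnhds : ∀ (s : Set ℝ) (t : ℝ), s ∈ 𝓝 (-t) → {x | -x ∈ s} ∈ 𝓝 t := fun s t hs =>
    continuous_neg.continuousAt.preimage_mem_nhds hs
  have key : ∃ t', Φ (- -y) (-t') ∧ 0 < (-(p'.comp (-X))).eval t' := by
    refine h.neg.exists_pos (-(p.comp (-X))) (-(p'.comp (-X)))
      (y := -y) (y' := -y') (by simpa using hy) ?_ ?_ ?_ ?_ ?_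
    · intro e e' he
      rcases hdich _ _ he with ⟨hf, hs⟩ | hn
      · refine Or.inl ⟨?_, ?_⟩
        · refine (hf.image fun x => -x).subset fun t ht => ⟨-t, ht, neg_neg t⟩
        · rw [hev, hev, Left.sign_neg, Left.sign_neg, hs]
      · exact Or.inr (hnhds _ _ hn)
    · intro t' ht'
      simp only [neg_neg] at ht' ⊢
      exact hnhds _ _ (hC' _ ht')
    · intro t ht
      rw [hder]
      exact hd _ (by simpa using ht)
    · intro t ht
      rw [hder]
      exact hd' _ (by simpa using ht)
    · obtain ⟨t, ht, hpt⟩ := hneg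
      refine ⟨-t, by simpa using ht, ?_⟩
      rw [hev, neg_neg]
      linarith
  obtain ⟨t', ht', hpos⟩ := key
  exact ⟨-t', by simpa using ht', by rw [hev] at hpos; linarith⟩

theorem exists_sign_eq_of_derivative_pos (h : IsCorrespondence Φ) (p p' : ℝ[X]) {y y' : ℝ}
    (hy : Φ y y')
    (hdich : ∀ e e', Φ e e' →
      ({t | Φ t e'}.Finite ∧ SignType.sign (p.eval e) = SignType.sign (p'.eval e')) ∨
      {t' | Φ e t'} ∈ 𝓝 e')
    (hC : {t | Φ t y'} ∈ 𝓝 y)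
    (hC' : ∀ t', Φ y t' → {t' | Φ y t'} ∈ 𝓝 t')
    (hd : ∀ t, Φ t y' → 0 < p.derivative.eval t)
    (hd' : ∀ t', Φ y t' → 0 < p'.derivative.eval t') :
    ∃ t', Φ y t' ∧ SignType.sign (p.eval y) = SignType.sign (p'.eval t') := by
  have hP := h.exists_pos p p' hy hdich hC' hd hd'
  have hN := h.exists_neg p p' hy hdich hC' hd hd'
  rcases lt_trichotomy (p.eval y) 0 with hlt | heq | hgt
  · obtain ⟨t', ht', hn⟩ := hN ⟨y, hy, hlt⟩
    exact ⟨t', ht', by rw [sign_neg hlt, sign_neg hn]⟩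
  -- At an interior zero, strict monotonicity yields both signs nearby. Both signs transfer to the
  -- other class, and the intermediate value theorem on that convex class gives a zero.
  · obtain ⟨ε, hε, hball⟩ := Metric.mem_nhds_iff.1 hC
    have hmono : StrictMonoOn (fun x => p.eval x) {t | Φ t y'} := by
      refine strictMonoOn_of_deriv_pos (h.convex_class y') p.continuous.continuousOn fun s hs => ?_
      rw [p.deriv]
      exact hd s (interior_subset (s := {t | Φ t y'}) hs)
    have hr : Φ (y + ε / 2) y' := hball (by simp [abs_of_pos, hε])
    have hl : Φ (y - ε / 2) y' := hball (by simp [abs_of_pos, hε])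
    have h1 : p.eval y < p.eval (y + ε / 2) := hmono hy hr (by linarith)
    have h2 : p.eval (y - ε / 2) < p.eval y := hmono hl hy (by linarith)
    obtain ⟨s, hs, hsp⟩ := hP ⟨_, hr, heq ▸ h1⟩
    obtain ⟨u, hu, hun⟩ := hN ⟨_, hl, heq ▸ h2⟩
    have hconv := h.symm.convex_class y
    obtain ⟨v, hv, hv0⟩ := hconv.isPreconnected.intermediate_value hu hs
      p'.continuous.continuousOn ⟨hun.le, hsp.le⟩
    simp only at hv0
    exact ⟨v, hv, by rw [heq, hv0]⟩
  · obtain ⟨t', ht', hn⟩ := hP ⟨y, hy, hgt⟩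
    exact ⟨t', ht', by rw [sign_pos hgt, sign_pos hn]⟩

theorem exists_sign_eq (h : IsCorrespondence Φ) (p p' : ℝ[X]) {y y' : ℝ}
    (hy : Φ y y')
    (hdich : ∀ e e', Φ e e' →
      ({t | Φ t e'}.Finite ∧ SignType.sign (p.eval e) = SignType.sign (p'.eval e')) ∨
      {t' | Φ e t'} ∈ 𝓝 e')
    (hC : {t | Φ t y'} ∈ 𝓝 y)
    (hC' : ∀ t', Φ y t' → {t' | Φ y t'} ∈ 𝓝 t')
    (hd0 : p.derivative.eval y ≠ 0)
    (hd : ∀ t, Φ t y' →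
      SignType.sign (p.derivative.eval t) = SignType.sign (p.derivative.eval y))
    (hd' : ∀ t', Φ y t' →
      SignType.sign (p'.derivative.eval t') = SignType.sign (p.derivative.eval y)) :
    ∃ t', Φ y t' ∧ SignType.sign (p.eval y) = SignType.sign (p'.eval t') := by
  rcases lt_or_gt_of_ne hd0 with hlt | hgt
  · rw [sign_neg hlt] at hd hd'
    simp only [sign_eq_neg_one_iff] at hd hd'
    obtain ⟨t', ht', hs⟩ := h.exists_sign_eq_of_derivative_pos (-p) (-p') hy
      (fun e e' he => by
        simpa only [eval_neg, Left.sign_neg, neg_inj] using hdich e e' he) hC hC'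
      (fun t ht => by simpa using hd t ht) (fun t ht => by simpa using hd' t ht)
    refine ⟨t', ht', ?_⟩
    simpa only [eval_neg, Left.sign_neg, neg_inj] using hs
  · rw [sign_pos hgt] at hd hd'
    simp only [sign_eq_one_iff] at hd hd'
    exact h.exists_sign_eq_of_derivative_pos p p' hy hdich hC hC' hd hd'

end IsCorrespondence

/-! ### Sign-preserving matchings, extended one polynomial at a time -/

/-- A correspondence between the fibres over `φ` and `φ'` that preserves the signs of the
polynomials in `H`, all of whose classes are open or consist of roots of members of `H`. -/
structure IsMatching {R : Type*} [CommRing R] (φ φ' : R →+* ℝ) (H : Set R[X])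
    (Φ : ℝ → ℝ → Prop) : Prop extends IsCorrespondence Φ where
  sign_eq : ∀ f ∈ H, ∀ y y', Φ y y' →
    SignType.sign (f.eval₂ φ y) = SignType.sign (f.eval₂ φ' y')
  special : ∀ y y', Φ y y' →
    (∃ g ∈ H, φ g.leadingCoeff ≠ 0 ∧ φ' g.leadingCoeff ≠ 0 ∧
      g.eval₂ φ y = 0 ∧ g.eval₂ φ' y' = 0) ∨
    ({t | Φ t y'} ∈ 𝓝 y ∧ {t' | Φ y t'} ∈ 𝓝 y')

theorem eventually_sign_eval₂_eq {R : Type*} [CommRing R] (f : R[X]) (φ : R →+* ℝ) {y : ℝ}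
    (h0 : f.eval₂ φ y ≠ 0) :
    ∀ᶠ t in 𝓝 y, SignType.sign (f.eval₂ φ t) = SignType.sign (f.eval₂ φ y) := by
  simp only [← eval_map] at h0 ⊢
  have hc : ContinuousAt (fun t => SignType.sign ((f.map φ).eval t)) y :=
    ContinuousAt.comp (f := fun t => (f.map φ).eval t) (continuousAt_sign_of_ne_zero h0)
      (f.map φ).continuous.continuousAt
  exact hc.eventually ((isOpen_discrete {SignType.sign ((f.map φ).eval y)}).mem_nhds rfl)

namespace IsMatching

variable {R : Type*} [CommRing R] {φ φ' : R →+* ℝ} {H : Set R[X]} {Φ : ℝ → ℝ → Prop}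

theorem symm (h : IsMatching φ φ' H Φ) : IsMatching φ' φ H fun y' y => Φ y y' where
  toIsCorrespondence := h.toIsCorrespondence.symm
  sign_eq f hf y y' hy := (h.sign_eq f hf y' y hy).symm
  special y y' hy := by
    rcases h.special y' y hy with ⟨g, hg, h1, h2, h3, h4⟩ | ⟨h1, h2⟩
    · exact Or.inl ⟨g, hg, h2, h1, h4, h3⟩
    · exact Or.inr ⟨h2, h1⟩

theorem insert_of_sign_eq (h : IsMatching φ φ' H Φ) (f : R[X])
    (hf : ∀ y y', Φ y y' → SignType.sign (f.eval₂ φ y) = SignType.sign (f.eval₂ φ' y')) :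
    IsMatching φ φ' (insert f H) Φ where
  toIsCorrespondence := h.toIsCorrespondence
  sign_eq := by
    rintro g (rfl | hg)
    exacts [hf, h.sign_eq g hg]
  special y y' hy := by
    rcases h.special y y' hy with ⟨g, hg, h'⟩ | h'
    · exact Or.inl ⟨g, Or.inr hg, h'⟩
    · exact Or.inr h'

theorem finite_class (h : IsMatching φ φ' H Φ) {y' : ℝ} {g : R[X]} (hg : g ∈ H)
    (hlc : φ g.leadingCoeff ≠ 0) (hroot : g.eval₂ φ' y' = 0) : {t | Φ t y'}.Finite := by
  have hne : g.map φ ≠ 0 := fun h0 => hlc (by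
    rw [leadingCoeff, ← coeff_map, h0, coeff_zero])
  refine (finite_setOfPred_isRoot hne).subset fun t ht => ?_
  have := h.sign_eq g hg t y' ht
  rw [hroot, sign_zero, sign_eq_zero_iff] at this
  rwa [Set.mem_ofPred_eq, IsRoot, eval_map]

/-- At matched roots of `g` the sign of `f` is that of a polynomial of lower degree, whose sign is
already matched. -/
theorem sign_eq_of_pseudoRem (h : IsMatching φ φ' H Φ) {f g : R[X]} {y y' : ℝ} (hy : Φ y y')
    (hlc : φ g.leadingCoeff ≠ 0) (hlc' : φ' g.leadingCoeff ≠ 0)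
    (hroot : g.eval₂ φ y = 0) (hroot' : g.eval₂ φ' y' = 0)
    (hrem : 0 < g.natDegree → pseudoRem f g ∈ H) :
    SignType.sign (f.eval₂ φ y) = SignType.sign (f.eval₂ φ' y') := by
  have hdeg : 0 < g.natDegree := by
    by_contra! h0
    rw [eq_C_of_natDegree_le_zero h0, eval₂_C] at hroot
    rw [leadingCoeff, Nat.le_zero.1 h0] at hlc
    exact hlc hroot
  obtain ⟨-, k, q, hq⟩ := pseudoRem_spec f g hdeg
  have key : ∀ (ψ : R →+* ℝ) (t : ℝ), ψ g.leadingCoeff ≠ 0 → g.eval₂ ψ t = 0 →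
      SignType.sign (f.eval₂ ψ t) = SignType.sign ((pseudoRem f g).eval₂ ψ t) := by
    intro ψ t h1 h2
    have := congrArg (eval₂ ψ t) hq
    rw [eval₂_mul, eval₂_add, eval₂_mul, h2, mul_zero, zero_add, eval₂_C, map_pow, pow_mul] at this
    have hpos : 0 < (ψ g.leadingCoeff ^ 2) ^ k := pow_pos (sq_pos_of_ne_zero h1) k
    rw [← this, sign_mul, sign_pos hpos, one_mul]
  rw [key φ y hlc hroot, key φ' y' hlc' hroot', h.sign_eq _ (hrem hdeg) _ _ hy]

theorem exists_sign_eq (h : IsMatching φ φ' H Φ) (f : R[X]) (hdeg : 0 < f.natDegree)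
    (hlc : φ f.leadingCoeff ≠ 0) (hder : derivative f ∈ H)
    (hrem : ∀ g ∈ H, 0 < g.natDegree → pseudoRem f g ∈ H) (y : ℝ) :
    ∃ y', Φ y y' ∧ SignType.sign (f.eval₂ φ y) = SignType.sign (f.eval₂ φ' y') := by
  obtain ⟨y', hy⟩ := h.total_left y
  rcases h.special y y' hy with ⟨g, hg, h1, h2, h3, h4⟩ | ⟨hn, hn'⟩
  · exact ⟨y', hy, h.sign_eq_of_pseudoRem hy h1 h2 h3 h4 (hrem g hg)⟩
  have hinf : {t | Φ t y'}.Infinite := infinite_of_mem_nhds y hn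
  have hcell : ∀ t', Φ y t' → {t | Φ t t'} = {t | Φ t y'} := fun t' ht' => Set.ext fun t =>
    ⟨fun ht => h.difunctional ht ht' hy, fun ht => h.difunctional ht hy ht'⟩
  have hsgn : ∀ t t', Φ t t' → SignType.sign ((f.map φ).derivative.eval t) =
      SignType.sign ((f.map φ').derivative.eval t') := by
    intro t t' ht
    rw [derivative_map, derivative_map, eval_map, eval_map]
    exact h.sign_eq _ hder t t' ht
  have hconst : ∀ t, Φ t y' → SignType.sign ((f.map φ).derivative.eval t) =
      SignType.sign ((f.map φ).derivative.eval y) := fun t ht => by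
    rw [hsgn t y' ht, hsgn y y' hy]
  have hd0 : (f.map φ).derivative.eval y ≠ 0 := by
    intro h0
    have hz : (f.map φ).derivative = 0 := by
      refine eq_zero_of_infinite_isRoot _ (hinf.mono fun t ht => ?_)
      have := hconst t ht
      rwa [h0, sign_zero, sign_eq_zero_iff] at this
    have h1 := derivative_eq_zero.1 hz
    rw [natDegree_map_of_leadingCoeff_ne_zero φ hlc] at h1
    omega
  simp only [← eval_map]
  refine h.toIsCorrespondence.exists_sign_eq (f.map φ) (f.map φ') hy ?_ hn ?_ hd0
    hconst (fun t' ht' => (hsgn y t' ht').symm)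
  · intro e e' he
    rcases h.special e e' he with ⟨g, hg, h1, h2, h3, h4⟩ | ⟨-, hn⟩
    · refine Or.inl ⟨h.finite_class hg h1 h4, ?_⟩
      rw [eval_map, eval_map]
      exact h.sign_eq_of_pseudoRem he h1 h2 h3 h4 (hrem g hg)
    · exact Or.inr hn
  · intro t' ht'
    rcases h.special y t' ht' with ⟨g, hg, h1, h2, h3, h4⟩ | ⟨-, hn⟩
    · exact absurd (hcell t' ht' ▸ h.finite_class hg h1 h4) hinf
    · exact hn

/-- Classes are split according to the sign of `f`. The old classes carry a constant sign of the
derivative, so `f` is monotone in the same direction on both sides. This preserves the order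
condition, while totality comes from `IsMatching.exists_sign_eq`. -/
theorem insert_refine (h : IsMatching φ φ' H Φ) (f : R[X]) (hdeg : 0 < f.natDegree)
    (hlc : φ f.leadingCoeff ≠ 0) (hlc' : φ' f.leadingCoeff ≠ 0) (hder : derivative f ∈ H)
    (hrem : ∀ g ∈ H, 0 < g.natDegree → pseudoRem f g ∈ H) :
    IsMatching φ φ' (insert f H) fun y y' =>
      Φ y y' ∧ SignType.sign (f.eval₂ φ y) = SignType.sign (f.eval₂ φ' y') where
  total_left := h.exists_sign_eq f hdeg hlc hder hrem
  total_right y' := by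
    obtain ⟨y, hy, hs⟩ := h.symm.exists_sign_eq f hdeg hlc' hder hrem y'
    exact ⟨y, hy, hs.symm⟩
  difunctional h1 h2 h3 :=
    ⟨h.difunctional h1.1 h2.1 h3.1, h1.2.trans (h2.2.symm.trans h3.2)⟩
  mono {a b a' b'} hab h1 h2 hle := by
    have hab' : Φ a b' := h.mono hab h1.1 h2.1 hle
    have hba' : Φ b a' := h.difunctional h2.1 hab' h1.1
    refine ⟨hab', ?_⟩
    have hder1 : ∀ t, Φ t a' → SignType.sign ((derivative f).eval₂ φ t) =
        SignType.sign ((derivative f).eval₂ φ' a') := fun t ht => h.sign_eq _ hder t a' ht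
    have hder2 : ∀ t', Φ a t' → SignType.sign ((derivative f).eval₂ φ' t') =
        SignType.sign ((derivative f).eval₂ φ' a') := fun t' ht' => by
      rw [← h.sign_eq _ hder a t' ht', hder1 a h1.1]
    have hd1 : ∀ t ∈ interior (Set.Icc a b), deriv (fun x => (f.map φ).eval x) t =
        (derivative f).eval₂ φ t := fun t _ => by
      rw [(f.map φ).deriv, derivative_map, eval_map]
    have hd2 : ∀ t ∈ interior (Set.Icc b' a'), deriv (fun x => (f.map φ').eval x) t =
        (derivative f).eval₂ φ' t := fun t _ => by
      rw [(f.map φ').deriv, derivative_map, eval_map]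
    have hc1 : ∀ t ∈ interior (Set.Icc a b), Φ t a' := fun t ht => by
      rw [interior_Icc] at ht
      exact h.between ht.1 ht.2 h1.1 hba'
    have hc2 : ∀ t ∈ interior (Set.Icc b' a'), Φ a t := fun t ht => by
      rw [interior_Icc] at ht
      exact h.between_right ht.1 ht.2 hab' h1.1
    have e1 := h1.2
    have e2 := h2.2
    rw [← eval_map, ← eval_map] at e1 e2 ⊢
    have hca : ContinuousOn (fun x => (f.map φ).eval x) (Set.Icc a b) :=
      (f.map φ).continuous.continuousOn
    have hcb : ContinuousOn (fun x => (f.map φ').eval x) (Set.Icc b' a') :=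
      (f.map φ').continuous.continuousOn
    have hda : DifferentiableOn ℝ (fun x => (f.map φ).eval x) (interior (Set.Icc a b)) :=
      (f.map φ).differentiable.differentiableOn
    have hdb : DifferentiableOn ℝ (fun x => (f.map φ').eval x) (interior (Set.Icc b' a')) :=
      (f.map φ').differentiable.differentiableOn
    rcases le_total 0 ((derivative f).eval₂ φ' a') with hsg | hsg
    · have m1 := monotoneOn_of_deriv_nonneg (convex_Icc a b) hca hda fun t ht => by
        rw [hd1 t ht, ← sign_nonneg_iff, hder1 t (hc1 t ht)]
        exact sign_nonneg_iff.2 hsg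
      have m2 := monotoneOn_of_deriv_nonneg (convex_Icc b' a') hcb hdb fun t ht => by
        rw [hd2 t ht, ← sign_nonneg_iff, hder2 t (hc2 t ht)]
        exact sign_nonneg_iff.2 hsg
      have i1 := SignType.sign.monotone (m1 (Set.left_mem_Icc.2 hab.le)
        (Set.right_mem_Icc.2 hab.le) hab.le)
      have i2 := SignType.sign.monotone (m2 (Set.left_mem_Icc.2 hle)
        (Set.right_mem_Icc.2 hle) hle)
      -- Going from `a` to `b`, across to `b'`, up to `a'` and back to `a`, the signs of `f`
      -- increase weakly around a cycle, so all four agree.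
      exact le_antisymm (i1.trans e2.le) (i2.trans e1.ge)
    · have m1 := antitoneOn_of_deriv_nonpos (convex_Icc a b) hca hda fun t ht => by
        rw [hd1 t ht, ← sign_nonpos_iff, hder1 t (hc1 t ht)]
        exact sign_nonpos_iff.2 hsg
      have m2 := antitoneOn_of_deriv_nonpos (convex_Icc b' a') hcb hdb fun t ht => by
        rw [hd2 t ht, ← sign_nonpos_iff, hder2 t (hc2 t ht)]
        exact sign_nonpos_iff.2 hsg
      have i1 := SignType.sign.monotone (m1 (Set.left_mem_Icc.2 hab.le)
        (Set.right_mem_Icc.2 hab.le) hab.le)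
      have i2 := SignType.sign.monotone (m2 (Set.left_mem_Icc.2 hle)
        (Set.right_mem_Icc.2 hle) hle)
      exact le_antisymm (e1.le.trans i2) (e2.ge.trans i1)
  sign_eq := by
    rintro g (rfl | hg) y y' hy
    exacts [hy.2, h.sign_eq g hg y y' hy.1]
  special y y' hy := by
    rcases h.special y y' hy.1 with ⟨g, hg, h'⟩ | ⟨hn, hn'⟩
    · exact Or.inl ⟨g, Or.inr hg, h'⟩
    by_cases h0 : f.eval₂ φ y = 0
    · refine Or.inl ⟨f, Or.inl rfl, hlc, hlc', h0, ?_⟩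
      rw [h0, sign_zero, eq_comm, sign_eq_zero_iff] at hy
      exact hy.2
    · have h0' : f.eval₂ φ' y' ≠ 0 := by
        rwa [← sign_ne_zero, ← hy.2, sign_ne_zero]
      refine Or.inr ⟨?_, ?_⟩
      · filter_upwards [hn, eventually_sign_eval₂_eq f φ h0] with t ht hs
        exact ⟨ht, hs.trans hy.2⟩
      · filter_upwards [hn', eventually_sign_eval₂_eq f φ' h0'] with t ht hs
        exact ⟨ht, hy.2.trans hs.symm⟩

end IsMatching

theorem exists_matching {R : Type*} [CommRing R] (φ φ' : R →+* ℝ) (E : Set R[X]) (hE : E.Finite)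
    (hder : ∀ g ∈ E, 0 < g.natDegree → derivative g ∈ E)
    (hlead : ∀ g ∈ E, 0 < g.natDegree → g.eraseLead ∈ E)
    (hrem : ∀ f ∈ E, ∀ g ∈ E, 0 < g.natDegree → g.natDegree ≤ f.natDegree → pseudoRem f g ∈ E)
    (hcoeff : ∀ g ∈ E, SignType.sign (φ g.leadingCoeff) = SignType.sign (φ' g.leadingCoeff)) :
    ∃ Φ, IsMatching φ φ' E Φ := by
  have key : ∀ n, ∃ Φ, IsMatching φ φ' {g ∈ E | g.natDegree < n} Φ := by
    intro n
    induction n with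
    | zero =>
      refine ⟨fun _ _ => True, ?_⟩
      constructor
      · constructor <;> intros <;> simp
      · simp
      · simp
    | succ n ih =>
      have hfin : {g ∈ E | g.natDegree = n}.Finite := hE.subset (Set.sep_subset _ _)
      have step : ∀ T ⊆ {g ∈ E | g.natDegree = n}, T.Finite →
          ∃ Φ, IsMatching φ φ' (T ∪ {g ∈ E | g.natDegree < n}) Φ := by
        intro T hT hTf
        induction T, hTf using Set.Finite.induction_on with
        | empty => simpa using ih
        | @insert f T hfT hTf ihT =>
          obtain ⟨Φ, hΦ⟩ := ihT ((Set.subset_insert _ _).trans hT)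
          obtain ⟨hfE, hfn⟩ := hT (Set.mem_insert _ _)
          have hTE : ∀ g ∈ T ∪ {g ∈ E | g.natDegree < n}, g ∈ E ∧ g.natDegree ≤ n := by
            rintro g (hg | hg)
            · have := hT (Or.inr hg)
              exact ⟨this.1, this.2.le⟩
            · exact ⟨hg.1, hg.2.le⟩
          rw [Set.insert_union]
          have hs := hcoeff f hfE
          by_cases hdeg : 0 < f.natDegree
          -- If the leading coefficient vanishes at one parameter it vanishes at both, and `f` has
          -- the values of `f.eraseLead`, which was treated at a lower degree.
          · by_cases hlc : φ f.leadingCoeff = 0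
            · have hlc' : φ' f.leadingCoeff = 0 := by
                rwa [hlc, sign_zero, eq_comm, sign_eq_zero_iff] at hs
              refine ⟨Φ, hΦ.insert_of_sign_eq f fun y y' hy => ?_⟩
              have hev : ∀ (ψ : R →+* ℝ) (t : ℝ), ψ f.leadingCoeff = 0 →
                  f.eval₂ ψ t = f.eraseLead.eval₂ ψ t := fun ψ t h0 => by
                conv_lhs => rw [← f.eraseLead_add_C_mul_X_pow]
                rw [eval₂_add, eval₂_mul, eval₂_C, h0, zero_mul, add_zero]
              rw [hev φ y hlc, hev φ' y' hlc']
              refine hΦ.sign_eq _ (Or.inr ⟨hlead f hfE hdeg, ?_⟩) y y' hy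
              have := f.eraseLead_natDegree_le
              omega
            · have hlc' : φ' f.leadingCoeff ≠ 0 := by
                rwa [← sign_ne_zero, ← hs, sign_ne_zero]
              refine ⟨_, hΦ.insert_refine f hdeg hlc hlc'
                (Or.inr ⟨hder f hfE hdeg, ?_⟩) fun g hg hg0 => Or.inr ⟨?_, ?_⟩⟩
              · have := natDegree_derivative_lt hdeg.ne'
                omega
              · exact hrem f hfE g (hTE g hg).1 hg0 (by rw [hfn]; exact (hTE g hg).2)
              · exact (pseudoRem_spec f g hg0).1.trans_le (hTE g hg).2
          · refine ⟨Φ, hΦ.insert_of_sign_eq f fun y y' hy => ?_⟩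
            have h0 : f.natDegree = 0 := by omega
            rw [leadingCoeff, h0] at hs
            rw [eq_C_of_natDegree_eq_zero h0, eval₂_C, eval₂_C, hs]
      obtain ⟨Φ, hΦ⟩ := step _ subset_rfl hfin
      refine ⟨Φ, ?_⟩
      convert hΦ using 1
      ext g
      simp only [Set.mem_union, Set.mem_ofPred_eq, ← and_or_left]
      exact and_congr_right fun _ => by omega
  obtain ⟨N, hN⟩ := (hE.image natDegree).bddAbove
  obtain ⟨Φ, hΦ⟩ := key (N + 1)
  refine ⟨Φ, ?_⟩
  convert hΦ using 1
  ext g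
  simp only [Set.mem_ofPred_eq]
  exact ⟨fun hg => ⟨hg, Nat.lt_succ_of_le (hN ⟨g, hg, rfl⟩)⟩, fun hg => hg.1⟩

/-- Elimination of one real variable: the signs of finitely many coefficients determine which
combinations of signs of the members of `F` occur. -/
theorem exists_finite_sign_determining {R : Type*} [CommRing R] (F : Set R[X]) (hF : F.Finite) :
    ∃ G : Set R, G.Finite ∧ ∀ φ φ' : R →+* ℝ,
      (∀ a ∈ G, SignType.sign (φ a) = SignType.sign (φ' a)) → ∀ y, ∃ y', ∀ f ∈ F,
        SignType.sign (f.eval₂ φ y) = SignType.sign (f.eval₂ φ' y') := by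
  obtain ⟨E, hFE, hE, hcl⟩ := exists_finite_closure natDegree
    (fun f g => {pseudoRem f g, derivative g, g.eraseLead}) (fun f g => by simp)
    (fun f g hg h hh => by
      rcases hh with rfl | rfl | rfl
      · exact (pseudoRem_spec f g hg).1
      · exact natDegree_derivative_lt hg.ne'
      · have := g.eraseLead_natDegree_le
        omega) F hF
  refine ⟨leadingCoeff '' E, hE.image _, fun φ φ' hφ y => ?_⟩
  obtain ⟨Φ, hΦ⟩ := exists_matching φ φ' E hE
    (fun g hg h0 => hcl g hg g hg h0 le_rfl (by simp))
    (fun g hg h0 => hcl g hg g hg h0 le_rfl (by simp))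
    (fun f hf g hg h0 h1 => hcl f hf g hg h0 h1 (by simp)) fun g hg => hφ _ ⟨g, hg, rfl⟩
  obtain ⟨y', hy⟩ := hΦ.total_left y
  exact ⟨y', fun f hf => hΦ.sign_eq f (hFE hf) y y' hy⟩

end Semialgebraic

namespace Semialgebraic

open Filter Topology

/-! ### Sets determined by the signs of finitely many integer polynomials -/

/-- Membership in `s` depends only on the signs of finitely many integer polynomials. -/
def SignDetermined {ι : Type} (s : Set (ι → ℝ)) : Prop :=
  ∃ F : Set (MvPolynomial ι ℤ), F.Finite ∧ ∀ x x' : ι → ℝ,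
    (∀ p ∈ F, SignType.sign (MvPolynomial.aeval x p) = SignType.sign (MvPolynomial.aeval x' p)) →
      x ∈ s → x' ∈ s

namespace SignDetermined

variable {ι κ : Type} {s t : Set (ι → ℝ)}

theorem const (P : Prop) : SignDetermined {_x : ι → ℝ | P} :=
  ⟨∅, Set.finite_empty, fun _ _ _ h => h⟩

theorem compl (hs : SignDetermined s) : SignDetermined sᶜ := by
  obtain ⟨F, hF, h⟩ := hs
  exact ⟨F, hF, fun x x' hx hxs hxs' => hxs (h x' x (fun p hp => (hx p hp).symm) hxs')⟩

theorem inter (hs : SignDetermined s) (ht : SignDetermined t) : SignDetermined (s ∩ t) := by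
  obtain ⟨F, hF, h⟩ := hs
  obtain ⟨G, hG, h'⟩ := ht
  exact ⟨F ∪ G, hF.union hG, fun x x' hx hxs =>
    ⟨h x x' (fun p hp => hx p (Or.inl hp)) hxs.1, h' x x' (fun p hp => hx p (Or.inr hp)) hxs.2⟩⟩

theorem union (hs : SignDetermined s) (ht : SignDetermined t) : SignDetermined (s ∪ t) := by
  rw [← compl_compl (s ∪ t), Set.compl_union]
  exact (hs.compl.inter ht.compl).compl

theorem and {P Q : (ι → ℝ) → Prop} (hP : SignDetermined {x | P x}) (hQ : SignDetermined {x | Q x}) :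
    SignDetermined {x | P x ∧ Q x} := hP.inter hQ

theorem or {P Q : (ι → ℝ) → Prop} (hP : SignDetermined {x | P x}) (hQ : SignDetermined {x | Q x}) :
    SignDetermined {x | P x ∨ Q x} := hP.union hQ

theorem not {P : (ι → ℝ) → Prop} (hP : SignDetermined {x | P x}) :
    SignDetermined {x | ¬ P x} := hP.compl

theorem imp {P Q : (ι → ℝ) → Prop} (hP : SignDetermined {x | P x}) (hQ : SignDetermined {x | Q x}) :
    SignDetermined {x | P x → Q x} := by
  simp only [imp_iff_not_or]
  exact hP.not.or hQ

theorem forall_finite {κ : Type*} [Finite κ] {P : κ → (ι → ℝ) → Prop}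
    (h : ∀ k, SignDetermined {x | P k x}) : SignDetermined {x | ∀ k, P k x} := by
  choose F hF h using h
  refine ⟨⋃ k, F k, Set.finite_iUnion hF, fun x x' hx hxs k => ?_⟩
  exact h k x x' (fun p hp => hx p (Set.mem_iUnion.2 ⟨k, hp⟩)) (hxs k)

theorem exists_finite {κ : Type*} [Finite κ] {P : κ → (ι → ℝ) → Prop}
    (h : ∀ k, SignDetermined {x | P k x}) : SignDetermined {x | ∃ k, P k x} := by
  have := (forall_finite fun k => (h k).not).not
  simpa only [not_forall, not_not] using this

theorem preimage_comp (hs : SignDetermined s) (e : ι → κ) :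
    SignDetermined {x : κ → ℝ | x ∘ e ∈ s} := by
  obtain ⟨F, hF, h⟩ := hs
  refine ⟨MvPolynomial.rename e '' F, hF.image _, fun x x' hx => h _ _ fun p hp => ?_⟩
  have := hx _ ⟨p, hp, rfl⟩
  rwa [MvPolynomial.aeval_rename, MvPolynomial.aeval_rename] at this

/-- This is projection along one coordinate: view the polynomials as univariate over the remaining
variables and let the two points play the role of the evaluations `φ` and `φ'`. -/
theorem exists_real {s : Set (Option ι → ℝ)} (hs : SignDetermined s) :
    SignDetermined {x : ι → ℝ | ∃ y : ℝ, (fun o => o.elim y x) ∈ s} := by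
  obtain ⟨F, hF, h⟩ := hs
  obtain ⟨G, hG, hdet⟩ := exists_finite_sign_determining
    (MvPolynomial.optionEquivLeft ℤ ι '' F) (hF.image _)
  refine ⟨G, hG, ?_⟩
  rintro x x' hx ⟨y, hy⟩
  have hev : ∀ (x : ι → ℝ) (y : ℝ) (p : MvPolynomial (Option ι) ℤ),
      (MvPolynomial.optionEquivLeft ℤ ι p).eval₂ (MvPolynomial.aeval x : _ →ₐ[ℤ] ℝ).toRingHom y =
        MvPolynomial.aeval (fun o : Option ι => o.elim y x) p := by
    intro x y p
    induction p using MvPolynomial.induction_on with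
    | C a =>
      rw [show (MvPolynomial.C a : MvPolynomial (Option ι) ℤ) = (a : MvPolynomial (Option ι) ℤ) by
        simp, map_intCast, map_intCast]
      exact map_intCast (Polynomial.eval₂RingHom
        (MvPolynomial.aeval x : _ →ₐ[ℤ] ℝ).toRingHom y) a
    | add p q hp hq => rw [map_add, Polynomial.eval₂_add, hp, hq, map_add]
    | mul_X p o hp =>
      rw [map_mul, Polynomial.eval₂_mul, hp, map_mul]
      cases o <;> simp
  obtain ⟨y', hy'⟩ := hdet (MvPolynomial.aeval x : _ →ₐ[ℤ] ℝ).toRingHom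
    (MvPolynomial.aeval x' : _ →ₐ[ℤ] ℝ).toRingHom hx y
  refine ⟨y', h _ _ (fun p hp => ?_) hy⟩
  rw [← hev, ← hev]
  exact hy' _ ⟨p, hp, rfl⟩

theorem exists_pi [Finite κ] {s : Set (ι ⊕ κ → ℝ)} (hs : SignDetermined s) :
    SignDetermined {x : ι → ℝ | ∃ y : κ → ℝ, Sum.elim x y ∈ s} := by
  revert ι
  refine Finite.induction_empty_option
    (P := fun κ => ∀ {ι : Type} {s : Set (ι ⊕ κ → ℝ)}, SignDetermined s →
      SignDetermined {x : ι → ℝ | ∃ y : κ → ℝ, Sum.elim x y ∈ s}) ?_ ?_ ?_ κ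
  · intro κ κ' e ih ι s hs
    have := ih (hs.preimage_comp (Sum.map id e.symm))
    convert this using 1
    ext x
    constructor
    · rintro ⟨y, hy⟩
      refine ⟨y ∘ e, ?_⟩
      have hxy : Sum.elim x (y ∘ e) ∘ Sum.map id e.symm = Sum.elim x y := by
        ext (i | k) <;> simp
      rwa [Set.mem_ofPred_eq, hxy]
    · rintro ⟨y, hy⟩
      refine ⟨y ∘ e.symm, ?_⟩
      have hxy : Sum.elim x y ∘ Sum.map id e.symm = Sum.elim x (y ∘ e.symm) := by
        ext (i | k) <;> simp
      rwa [← hxy]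
  · intro ι s hs
    have := hs.preimage_comp (Sum.elim id PEmpty.elim)
    convert this using 1
    ext x
    have hx : ∀ y : PEmpty.{1} → ℝ, Sum.elim x y = x ∘ Sum.elim id PEmpty.elim := fun y => by
      ext (i | k)
      · rfl
      · exact k.elim
    simp only [Set.mem_ofPred_eq, hx]
    exact exists_const _
  · intro κ _ ih ι s hs
    have := ih (hs.preimage_comp (Sum.elim (fun i => some (Sum.inl i))
      (fun k => k.map Sum.inr))).exists_real
    convert this using 1
    ext x
    have hx : ∀ (y : Option κ → ℝ), Sum.elim x y =
        (fun o : Option (ι ⊕ κ) => o.elim (y none) (Sum.elim x (y ∘ some))) ∘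
          (Sum.elim (fun i => some (Sum.inl i)) (fun k => k.map Sum.inr)) := fun y => by
      ext (i | (_ | k)) <;> rfl
    constructor
    · rintro ⟨y, hy⟩
      rw [hx] at hy
      exact ⟨y ∘ some, y none, hy⟩
    · rintro ⟨y, t, hy⟩
      refine ⟨fun o => o.elim t y, ?_⟩
      rw [hx]
      exact hy

theorem forall_pi [Finite κ] {s : Set (ι ⊕ κ → ℝ)} (hs : SignDetermined s) :
    SignDetermined {x : ι → ℝ | ∀ y : κ → ℝ, Sum.elim x y ∈ s} := by
  have := hs.compl.exists_pi.not
  simpa only [Set.mem_compl_iff, not_exists, not_not] using this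

/-- An algebraic number is singled out by an integer polynomial vanishing at it and a rational
interval containing no other root. Denominators of the endpoints are cleared to get integer
polynomials. -/
theorem eq_algebraic (i : ι) {a : ℝ} (ha : IsAlgebraic ℚ a) :
    SignDetermined {x : ι → ℝ | x i = a} := by
  obtain ⟨f, hf, hfa⟩ := (IsFractionRing.isAlgebraic_iff ℤ ℚ ℝ).2 ha
  have hZ : (f.rootSet ℝ \ {a}).Finite := (f.rootSet_finite ℝ).subset Set.sdiff_subset
  obtain ⟨ε, hε, hball⟩ := Metric.isOpen_iff.1 hZ.isClosed.isOpen_compl a (by simp)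
  obtain ⟨l, hl1, hl2⟩ := exists_rat_btwn (show a - ε < a by linarith)
  obtain ⟨u, hu1, hu2⟩ := exists_rat_btwn (show a < a + ε by linarith)
  have hlin : ∀ (x : ι → ℝ) (q : ℚ), MvPolynomial.aeval x
      ((q.den : MvPolynomial ι ℤ) * MvPolynomial.X i - MvPolynomial.C q.num) =
      (q.den : ℝ) * (x i - q) := by
    intro x q
    have : (q.den : ℝ) * (q : ℝ) = q.num := by exact_mod_cast Rat.den_mul_eq_num q
    simp [mul_sub, this]
  have hden : ∀ q : ℚ, 0 < (q.den : ℝ) := fun q => by exact_mod_cast q.pos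
  have hsgn : ∀ (x : ι → ℝ) (q : ℚ), SignType.sign (MvPolynomial.aeval x
      ((q.den : MvPolynomial ι ℤ) * MvPolynomial.X i - MvPolynomial.C q.num)) =
      SignType.sign (x i - q) := fun x q => by
    rw [hlin, sign_mul, sign_pos (hden q), one_mul]
  have hfx : ∀ x : ι → ℝ, MvPolynomial.aeval x
      (Polynomial.aeval (MvPolynomial.X i : MvPolynomial ι ℤ) f) = Polynomial.aeval (x i) f := by
    intro x
    rw [← Polynomial.aeval_algHom_apply, MvPolynomial.aeval_X]
  refine ⟨{Polynomial.aeval (MvPolynomial.X i : MvPolynomial ι ℤ) f,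
    (l.den : MvPolynomial ι ℤ) * MvPolynomial.X i - MvPolynomial.C l.num,
    (u.den : MvPolynomial ι ℤ) * MvPolynomial.X i - MvPolynomial.C u.num}, by simp, ?_⟩
  intro x x' hx hxa
  simp only [Set.mem_ofPred_eq] at hxa ⊢
  have h1 := hx _ (Or.inl rfl)
  have h2 := hx _ (Or.inr (Or.inl rfl))
  have h3 := hx _ (Or.inr (Or.inr rfl))
  rw [hfx, hfx, hxa, hfa, sign_zero, eq_comm, sign_eq_zero_iff] at h1
  rw [hsgn, hsgn, hxa, sign_pos (sub_pos.2 hl2), eq_comm, sign_eq_one_iff] at h2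
  rw [hsgn, hsgn, hxa, sign_neg (sub_neg.2 hu1), eq_comm, sign_eq_neg_one_iff] at h3
  by_contra hne
  refine hball (a := x' i) ?_ ⟨?_, hne⟩
  · rw [Metric.mem_ball, Real.dist_eq, abs_lt]
    constructor <;> linarith
  · rw [Polynomial.mem_rootSet]
    exact ⟨hf, h1⟩

/-- There are finitely many sign vectors on `F`, and `s` is the union of the cells of those realised
in `s`. -/
theorem isSemialgebraic {d : ℕ} {s : Set (Fin d → ℝ)} (hs : SignDetermined s) :
    LinearLoop.IsSemialgebraic s := by
  obtain ⟨F, hF, h⟩ := hs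
  have huniv : LinearLoop.IsSemialgebraic (Set.univ : Set (Fin d → ℝ)) := by
    convert LinearLoop.IsSemialgebraic.basic (0 : MvPolynomial (Fin d) ℤ) using 1
    ext x
    simp
  have hsign : ∀ (p : MvPolynomial (Fin d) ℤ) (σ : SignType), LinearLoop.IsSemialgebraic
      {x : Fin d → ℝ | SignType.sign (MvPolynomial.aeval x p) = σ} := by
    intro p σ
    have hp := LinearLoop.IsSemialgebraic.basic p
    have hn := LinearLoop.IsSemialgebraic.basic (-p)
    cases σ
    · convert hp.inter _ _ hn using 1
      ext x
      rw [Set.mem_ofPred_eq, SignType.zero_eq_zero, sign_eq_zero_iff, le_antisymm_iff, and_comm]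
      simp only [map_neg, Set.mem_inter_iff, neg_nonneg, Set.mem_ofPred_eq]
    · convert hp.compl using 1
      ext x
      simp only [Set.mem_ofPred_eq, SignType.neg_eq_neg_one, sign_eq_neg_one_iff,
        Set.mem_compl_iff, not_le]
    · convert hn.compl using 1
      ext x
      simp only [Set.mem_ofPred_eq, SignType.pos_eq_one, sign_eq_one_iff,
        Set.mem_compl_iff, not_le, map_neg, Left.neg_neg_iff]
  have hall : ∀ τ : MvPolynomial (Fin d) ℤ → SignType, ∀ G : Set (MvPolynomial (Fin d) ℤ),
      G.Finite → LinearLoop.IsSemialgebraic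
        {x : Fin d → ℝ | ∀ p ∈ G, SignType.sign (MvPolynomial.aeval x p) = τ p} := by
    intro τ G hG
    induction G, hG using Set.Finite.induction_on with
    | empty => simpa [Set.ofPred_true] using huniv
    | @insert p G _ _ ih =>
      convert (hsign p (τ p)).inter _ _ ih using 1
      ext x
      simp
  have hunion : ∀ T : Set (F → SignType), T.Finite → LinearLoop.IsSemialgebraic
      {x : Fin d → ℝ | ∃ τ ∈ T, ∀ p : F, SignType.sign (MvPolynomial.aeval x p.1) = τ p} := by
    intro T hT
    induction T, hT using Set.Finite.induction_on with
    | empty =>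
      convert huniv.compl using 1
      ext x
      simp
    | @insert τ T _ _ ih =>
      classical
      convert (hall (fun p => if hp : p ∈ F then τ ⟨p, hp⟩ else 0) F hF).union _ _ ih using 1
      ext x
      simp only [Set.mem_insert_iff, exists_eq_or_imp, Set.mem_ofPred_eq, Set.mem_union]
      refine or_congr_left ⟨fun hx p hp => ?_, fun hx p => ?_⟩
      · rw [dif_pos hp]
        exact hx ⟨p, hp⟩
      · rw [hx p.1 p.2, dif_pos p.2]
  have : Finite F := hF
  convert hunion {τ | ∃ x ∈ s, ∀ p : F, SignType.sign (MvPolynomial.aeval x p.1) = τ p}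
    (Set.toFinite _) using 1
  ext x
  constructor
  · exact fun hx => ⟨fun p => SignType.sign (MvPolynomial.aeval x p.1), ⟨x, hx, fun _ => rfl⟩,
      fun _ => rfl⟩
  · rintro ⟨τ, ⟨x', hx', hτ⟩, hx⟩
    exact h x' x (fun p hp => (hτ ⟨p, hp⟩).trans (hx ⟨p, hp⟩).symm) hx'

end SignDetermined

/-! ### Polynomial functions with algebraic coefficients -/

/-- Real functions obtained from the coordinates and algebraic constants by addition and
multiplication. -/
inductive IsAlgPolynomial {ι : Type} : ((ι → ℝ) → ℝ) → Prop
  | coord (i : ι) : IsAlgPolynomial fun x => x i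
  | const {a : ℝ} (ha : IsAlgebraic ℚ a) : IsAlgPolynomial fun _ => a
  | add {f g : (ι → ℝ) → ℝ} : IsAlgPolynomial f → IsAlgPolynomial g →
      IsAlgPolynomial fun x => f x + g x
  | mul {f g : (ι → ℝ) → ℝ} : IsAlgPolynomial f → IsAlgPolynomial g →
      IsAlgPolynomial fun x => f x * g x

namespace IsAlgPolynomial

variable {ι : Type} {f g : (ι → ℝ) → ℝ}

theorem neg (hf : IsAlgPolynomial f) : IsAlgPolynomial fun x => -f x := by
  simpa using (const (isAlgebraic_one (R := ℚ)).neg).mul hf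

theorem sub (hf : IsAlgPolynomial f) (hg : IsAlgPolynomial g) :
    IsAlgPolynomial fun x => f x - g x := by
  simpa [sub_eq_add_neg] using hf.add hg.neg

/-- Algebraic constants are turned into extra variables, which `eq_algebraic` pins down and
`exists_pi` then eliminates. -/
theorem exists_aeval (hf : IsAlgPolynomial f) : ∃ (J : Type) (_ : Finite J) (α : J → ℝ),
    (∀ j, IsAlgebraic ℚ (α j)) ∧ ∃ p : MvPolynomial (ι ⊕ J) ℤ,
      ∀ x, f x = MvPolynomial.aeval (Sum.elim x α) p := by
  have hl : ∀ {J J' : Type} (α : J → ℝ) (α' : J' → ℝ) (x : ι → ℝ) (p : MvPolynomial (ι ⊕ J) ℤ),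
      MvPolynomial.aeval (Sum.elim x α) p = MvPolynomial.aeval (Sum.elim x (Sum.elim α α'))
        (MvPolynomial.rename (Sum.map id Sum.inl) p) := by
    intro J J' α α' x p
    rw [MvPolynomial.aeval_rename]
    congr 2
    ext (i | j) <;> rfl
  have hr : ∀ {J J' : Type} (α : J → ℝ) (α' : J' → ℝ) (x : ι → ℝ) (p : MvPolynomial (ι ⊕ J') ℤ),
      MvPolynomial.aeval (Sum.elim x α') p = MvPolynomial.aeval (Sum.elim x (Sum.elim α α'))
        (MvPolynomial.rename (Sum.map id Sum.inr) p) := by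
    intro J J' α α' x p
    rw [MvPolynomial.aeval_rename]
    congr 2
    ext (i | j) <;> rfl
  induction hf with
  | coord i =>
    exact ⟨Empty, inferInstance, Empty.elim, fun j => j.elim, MvPolynomial.X (Sum.inl i),
      fun x => by simp⟩
  | @const a ha =>
    exact ⟨Unit, inferInstance, fun _ => a, fun _ => ha, MvPolynomial.X (Sum.inr ()),
      fun x => by simp⟩
  | add _ _ ih1 ih2 =>
    obtain ⟨J, _, α, hα, p, hp⟩ := ih1
    obtain ⟨J', _, α', hα', p', hp'⟩ := ih2
    refine ⟨J ⊕ J', inferInstance, Sum.elim α α', Sum.rec hα hα',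
      MvPolynomial.rename (Sum.map id Sum.inl) p + MvPolynomial.rename (Sum.map id Sum.inr) p',
      fun x => ?_⟩
    simp only [map_add, ← hl, ← hr, hp, hp']
  | mul _ _ ih1 ih2 =>
    obtain ⟨J, _, α, hα, p, hp⟩ := ih1
    obtain ⟨J', _, α', hα', p', hp'⟩ := ih2
    refine ⟨J ⊕ J', inferInstance, Sum.elim α α', Sum.rec hα hα',
      MvPolynomial.rename (Sum.map id Sum.inl) p * MvPolynomial.rename (Sum.map id Sum.inr) p',
      fun x => ?_⟩
    simp only [map_mul, ← hl, ← hr, hp, hp']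

theorem signDetermined_nonneg (hf : IsAlgPolynomial f) : SignDetermined {x | 0 ≤ f x} := by
  obtain ⟨J, _, α, hα, p, hp⟩ := hf.exists_aeval
  have h1 : SignDetermined {v : ι ⊕ J → ℝ | 0 ≤ MvPolynomial.aeval v p} :=
    ⟨{p}, Set.finite_singleton p, fun x x' hx hx0 => by
      rw [Set.mem_ofPred_eq, ← sign_nonneg_iff] at hx0 ⊢
      rwa [← hx p rfl]⟩
  have h2 : SignDetermined {v : ι ⊕ J → ℝ | ∀ j, v (Sum.inr j) = α j} :=
    SignDetermined.forall_finite fun j => SignDetermined.eq_algebraic _ (hα j)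
  convert (h2.and h1).exists_pi using 1
  ext x
  simp only [Set.mem_ofPred_eq, Sum.elim_inr, hp]
  constructor
  · exact fun h => ⟨α, fun _ => rfl, h⟩
  · rintro ⟨y, hy, h⟩
    obtain rfl : y = α := funext hy
    exact h

theorem signDetermined_pos (hf : IsAlgPolynomial f) : SignDetermined {x | 0 < f x} := by
  simpa using hf.neg.signDetermined_nonneg.not

theorem signDetermined_eq_zero (hf : IsAlgPolynomial f) : SignDetermined {x | f x = 0} := by
  convert hf.neg.signDetermined_nonneg.and hf.signDetermined_nonneg using 3
  rw [neg_nonneg, le_antisymm_iff]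

end IsAlgPolynomial

/-- Complex functions whose real and imaginary parts are polynomials with algebraic
coefficients. -/
structure IsComplexAlgPolynomial {ι : Type} (f : (ι → ℝ) → ℂ) : Prop where
  re : IsAlgPolynomial fun x => (f x).re
  im : IsAlgPolynomial fun x => (f x).im

theorem _root_.Complex.isAlgebraic_conj {z : ℂ} (hz : IsAlgebraic ℚ z) :
    IsAlgebraic ℚ (starRingEnd ℂ z) :=
  hz.algHom (Complex.conjAe.toAlgHom.restrictScalars ℚ)

theorem _root_.Complex.isAlgebraic_ofReal {a : ℝ} :
    IsAlgebraic ℚ (a : ℂ) ↔ IsAlgebraic ℚ a :=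
  isAlgebraic_algebraMap_iff (R := ℚ) (S := ℝ) (A := ℂ) Complex.ofReal_injective

theorem _root_.Complex.isAlgebraic_re {z : ℂ} (hz : IsAlgebraic ℚ z) : IsAlgebraic ℚ z.re := by
  rw [← Complex.isAlgebraic_ofReal, Complex.re_eq_add_conj, div_eq_mul_inv]
  exact (hz.add (Complex.isAlgebraic_conj hz)).mul (isAlgebraic_algebraMap (2 : ℚ)).inv

theorem _root_.Complex.isAlgebraic_im {z : ℂ} (hz : IsAlgebraic ℚ z) : IsAlgebraic ℚ z.im := by
  have hI : IsAlgebraic ℚ Complex.I := Complex.isIntegral_rat_I.isAlgebraic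
  have := Complex.isAlgebraic_re ((hI.mul hz).neg)
  simpa using this

namespace IsComplexAlgPolynomial

variable {ι : Type} {f g : (ι → ℝ) → ℂ}

theorem const {a : ℂ} (ha : IsAlgebraic ℚ a) : IsComplexAlgPolynomial fun _ : ι → ℝ => a :=
  ⟨.const (Complex.isAlgebraic_re ha), .const (Complex.isAlgebraic_im ha)⟩

theorem mk_coord (i j : ι) : IsComplexAlgPolynomial fun x : ι → ℝ => (⟨x i, x j⟩ : ℂ) :=
  ⟨.coord i, .coord j⟩

theorem ofReal {f : (ι → ℝ) → ℝ} (hf : IsAlgPolynomial f) :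
    IsComplexAlgPolynomial fun x => (f x : ℂ) :=
  ⟨by simpa using hf, by simpa using IsAlgPolynomial.const (isAlgebraic_zero (R := ℚ))⟩

theorem add (hf : IsComplexAlgPolynomial f) (hg : IsComplexAlgPolynomial g) :
    IsComplexAlgPolynomial fun x => f x + g x :=
  ⟨hf.re.add hg.re, hf.im.add hg.im⟩

theorem sub (hf : IsComplexAlgPolynomial f) (hg : IsComplexAlgPolynomial g) :
    IsComplexAlgPolynomial fun x => f x - g x :=
  ⟨hf.re.sub hg.re, hf.im.sub hg.im⟩

theorem mul (hf : IsComplexAlgPolynomial f) (hg : IsComplexAlgPolynomial g) :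
    IsComplexAlgPolynomial fun x => f x * g x :=
  ⟨by simpa using (hf.re.mul hg.re).sub (hf.im.mul hg.im),
    by simpa using (hf.re.mul hg.im).add (hf.im.mul hg.re)⟩

theorem sum {κ : Type*} (s : Finset κ) {f : κ → (ι → ℝ) → ℂ}
    (hf : ∀ k ∈ s, IsComplexAlgPolynomial (f k)) :
    IsComplexAlgPolynomial fun x => ∑ k ∈ s, f k x := by
  classical
  induction s using Finset.induction_on with
  | empty => simpa using const (isAlgebraic_zero (R := ℚ))
  | insert a s ha ih =>
    simp only [Finset.sum_insert ha]
    exact (hf a (by simp)).add (ih fun k hk => hf k (by simp [hk]))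

theorem prod {κ : Type*} (s : Finset κ) {f : κ → (ι → ℝ) → ℂ}
    (hf : ∀ k ∈ s, IsComplexAlgPolynomial (f k)) :
    IsComplexAlgPolynomial fun x => ∏ k ∈ s, f k x := by
  classical
  induction s using Finset.induction_on with
  | empty => simpa using const (isAlgebraic_one (R := ℚ))
  | insert a s ha ih =>
    simp only [Finset.prod_insert ha]
    exact (hf a (by simp)).mul (ih fun k hk => hf k (by simp [hk]))

theorem pow (hf : IsComplexAlgPolynomial f) (n : ℕ) :
    IsComplexAlgPolynomial fun x => f x ^ n := by
  simpa using prod (Finset.range n) fun _ _ => hf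

theorem signDetermined_eq (hf : IsComplexAlgPolynomial f) (hg : IsComplexAlgPolynomial g) :
    SignDetermined {x | f x = g x} := by
  convert (hf.re.sub hg.re).signDetermined_eq_zero.and
    (hf.im.sub hg.im).signDetermined_eq_zero using 3
  rw [Complex.ext_iff, sub_eq_zero, sub_eq_zero]

theorem signDetermined_norm_eq_one (hf : IsComplexAlgPolynomial f) :
    SignDetermined {x | ‖f x‖ = 1} := by
  convert (((hf.re.mul hf.re).add (hf.im.mul hf.im)).sub
    (.const (isAlgebraic_one (R := ℚ)))).signDetermined_eq_zero using 3
  rw [sub_eq_zero, ← Complex.normSq_apply, Complex.normSq_eq_norm_sq,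
    pow_eq_one_iff_of_nonneg (norm_nonneg _) two_ne_zero]

end IsComplexAlgPolynomial

/-! ### Sequences of mean zero -/

/-- The averages of the sequence `a` tend to zero. -/
def MeanZero (a : ℕ → ℂ) : Prop :=
  Tendsto (fun N : ℕ => (N⁻¹ : ℝ) • ∑ n ∈ Finset.range N, a n) atTop (𝓝 0)

namespace MeanZero

variable {a b : ℕ → ℂ}

theorem of_tendsto (h : Tendsto a atTop (𝓝 0)) : MeanZero a := h.cesaro_smul

theorem add (ha : MeanZero a) (hb : MeanZero b) : MeanZero fun n => a n + b n := by
  have := Tendsto.add ha hb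
  simpa only [MeanZero, Finset.sum_add_distrib, smul_add, add_zero] using this

theorem const_mul (c : ℂ) (ha : MeanZero a) : MeanZero fun n => c * a n := by
  have := Tendsto.const_mul c ha
  simpa only [MeanZero, ← Finset.mul_sum, mul_smul_comm, mul_zero] using this

theorem sub (ha : MeanZero a) (hb : MeanZero b) : MeanZero fun n => a n - b n := by
  simpa [sub_eq_add_neg] using ha.add (hb.const_mul (-1))

theorem sum {κ : Type*} (s : Finset κ) {a : κ → ℕ → ℂ} (h : ∀ k ∈ s, MeanZero (a k)) :
    MeanZero fun n => ∑ k ∈ s, a k n := by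
  classical
  induction s using Finset.induction_on with
  | empty => exact of_tendsto (by simp)
  | insert k s hk ih =>
    simp only [Finset.sum_insert hk]
    exact (h k (by simp)).add (ih fun j hj => h j (by simp [hj]))

theorem geometric {ζ : ℂ} (h1 : ‖ζ‖ = 1) (hne : ζ ≠ 1) : MeanZero fun n => ζ ^ n := by
  have hlim : Tendsto (fun N : ℕ => (N⁻¹ : ℝ) * (2 / ‖ζ - 1‖)) atTop (𝓝 0) := by
    simpa using (tendsto_inv_atTop_nhds_zero_nat (𝕜 := ℝ)).mul_const (2 / ‖ζ - 1‖)
  refine squeeze_zero_norm (fun N => ?_) hlim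
  rw [geom_sum_eq hne, norm_smul, norm_div, Real.norm_of_nonneg (by positivity)]
  gcongr
  calc ‖ζ ^ N - 1‖ ≤ ‖ζ ^ N‖ + ‖(1 : ℂ)‖ := norm_sub_le _ _
    _ = 2 := by rw [norm_pow, h1]; norm_num

theorem of_const {c : ℂ} (h : MeanZero fun _ => c) : c = 0 :=
  tendsto_nhds_unique (Tendsto.cesaro_smul tendsto_const_nhds) h

theorem of_forall_norm_le (hb : MeanZero b) (h : ∀ N, ‖∑ n ∈ Finset.range N, a n‖ ≤
    ‖∑ n ∈ Finset.range N, b n‖) : MeanZero a := by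
  refine squeeze_zero_norm (fun N => ?_) (tendsto_zero_iff_norm_tendsto_zero.1 hb)
  rw [norm_smul, norm_smul]
  gcongr
  exact h N

theorem of_approx (h : ∀ ε > 0, ∃ b, MeanZero b ∧ ∀ n, ‖a n - b n‖ ≤ ε) : MeanZero a := by
  rw [MeanZero, Metric.tendsto_atTop]
  intro ε hε
  obtain ⟨b, hb, hab⟩ := h (ε / 2) (half_pos hε)
  obtain ⟨N₀, hN₀⟩ := Metric.tendsto_atTop.1 hb (ε / 2) (half_pos hε)
  refine ⟨N₀, fun N hN => ?_⟩
  have h1 := hN₀ N hN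
  rw [dist_zero_right] at h1 ⊢
  have h2 : ‖(N⁻¹ : ℝ) • ∑ n ∈ Finset.range N, (a n - b n)‖ ≤ ε / 2 := by
    rw [norm_smul, Real.norm_of_nonneg (by positivity)]
    have h3 : ‖∑ n ∈ Finset.range N, (a n - b n)‖ ≤ N * (ε / 2) := by
      refine (norm_sum_le _ _).trans ((Finset.sum_le_sum fun n _ => hab n).trans ?_)
      simp
    calc (N⁻¹ : ℝ) * ‖∑ n ∈ Finset.range N, (a n - b n)‖ ≤ (N⁻¹ : ℝ) * (N * (ε / 2)) := by gcongr
      _ = ((N⁻¹ : ℝ) * N) * (ε / 2) := by ring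
      _ ≤ 1 * (ε / 2) := by gcongr; exact inv_mul_le_one
      _ = ε / 2 := one_mul _
  have h4 : (N⁻¹ : ℝ) • ∑ n ∈ Finset.range N, a n = (N⁻¹ : ℝ) • ∑ n ∈ Finset.range N, (a n - b n) +
      (N⁻¹ : ℝ) • ∑ n ∈ Finset.range N, b n := by
    rw [← smul_add, ← Finset.sum_add_distrib]
    simp
  rw [h4]
  exact (norm_add_le _ _).trans_lt (by linarith)

/-- For nonnegative terms the mean is the mean of absolute values, so a bounded twist cannot destroy
convergence to zero. Taking `max (s n) 0` deals with the finitely many negative terms. -/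
theorem mul_of_nonneg {s : ℕ → ℝ} {u : ℕ → ℂ} (hs : MeanZero fun n => (s n : ℂ))
    (h0 : ∀ᶠ n in atTop, 0 ≤ s n) (hu : ∀ n, ‖u n‖ ≤ 1) : MeanZero fun n => (s n : ℂ) * u n := by
  have hev : ∀ᶠ n in atTop, max (s n) 0 = s n := h0.mono fun n hn => max_eq_left hn
  have h1 : MeanZero fun n => ((max (s n) 0 : ℝ) : ℂ) := by
    have : MeanZero fun n => ((max (s n) 0 : ℝ) : ℂ) - (s n : ℂ) :=
      of_tendsto (tendsto_const_nhds.congr' (hev.mono fun n hn => by simp only [hn, sub_self]))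
    simpa using this.add hs
  have h2 : MeanZero fun n => ((max (s n) 0 : ℝ) : ℂ) * u n := by
    refine h1.of_forall_norm_le fun N => (norm_sum_le _ _).trans ?_
    rw [← Complex.ofReal_sum, Complex.norm_of_nonneg
      (Finset.sum_nonneg fun n _ => le_max_right _ _)]
    refine Finset.sum_le_sum fun n _ => ?_
    rw [norm_mul, Complex.norm_of_nonneg (le_max_right _ _)]
    exact mul_le_of_le_one_right (le_max_right _ _) (hu n)
  have h3 : MeanZero fun n => (s n : ℂ) * u n - ((max (s n) 0 : ℝ) : ℂ) * u n :=
    of_tendsto (tendsto_const_nhds.congr' (hev.mono fun n hn => by simp only [hn, sub_self]))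
  simpa using h3.add h2

end MeanZero

/-- Without a constant term the sequence has mean zero. Being eventually nonnegative, it still has
mean zero after multiplication by `(ζ j)⁻¹ ^ n`, yet that mean is the Fourier coefficient `c j`. -/
theorem eq_zero_of_eventually_nonneg {I : Type*} [Fintype I] {ζ : I → ℂ}
    (hinj : Function.Injective ζ) (hnorm : ∀ i, ‖ζ i‖ = 1) {c : I → ℂ}
    (hc : ∀ i, ζ i = 1 → c i = 0) {s : ℕ → ℝ}
    (hs : Tendsto (fun n => (s n : ℂ) - ∑ i, c i * ζ i ^ n) atTop (𝓝 0))
    (h0 : ∀ᶠ n in atTop, 0 ≤ s n) (j : I) : c j = 0 := by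
  have hζ0 : ∀ i, ζ i ≠ 0 := fun i h => by simpa [h] using hnorm i
  have hmean : MeanZero fun n => ∑ i, c i * ζ i ^ n := by
    refine MeanZero.sum _ fun i _ => ?_
    by_cases hi : ζ i = 1
    · simp only [hc i hi, zero_mul]
      exact .of_tendsto tendsto_const_nhds
    · exact (MeanZero.geometric (hnorm i) hi).const_mul _
  have hsm : MeanZero fun n => (s n : ℂ) := by
    simpa using (MeanZero.of_tendsto hs).add hmean
  have hu : ∀ n, ‖(ζ j)⁻¹ ^ n‖ = 1 := fun n => by rw [norm_pow, norm_inv, hnorm]; simp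
  have h1 := hsm.mul_of_nonneg h0 fun n => (hu n).le
  have h2 : MeanZero fun n => ((s n : ℂ) - ∑ i, c i * ζ i ^ n) * (ζ j)⁻¹ ^ n := by
    refine .of_tendsto (squeeze_zero_norm (fun n => ?_)
      (tendsto_zero_iff_norm_tendsto_zero.1 hs))
    rw [norm_mul, hu, mul_one]
  classical
  have h3 : MeanZero fun n => ∑ i ∈ Finset.univ.erase j, c i * (ζ i / ζ j) ^ n := by
    refine MeanZero.sum _ fun i hi => (MeanZero.geometric ?_ fun h => ?_).const_mul _
    · rw [norm_div, hnorm, hnorm, div_one]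
    · exact Finset.ne_of_mem_erase hi (hinj ((div_eq_one_iff_eq (hζ0 j)).1 h))
  have h4 := (h1.sub h2).sub h3
  refine MeanZero.of_const ((congrArg MeanZero (funext fun n => ?_)).mp h4)
  have h5 : ∑ i, c i * ζ i ^ n = c j * ζ j ^ n + ∑ i ∈ Finset.univ.erase j, c i * ζ i ^ n :=
    (Finset.add_sum_erase _ _ (Finset.mem_univ j)).symm
  have h6 : ∑ i ∈ Finset.univ.erase j, c i * (ζ i / ζ j) ^ n =
      (∑ i ∈ Finset.univ.erase j, c i * ζ i ^ n) * (ζ j)⁻¹ ^ n := by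
    rw [Finset.sum_mul]
    refine Finset.sum_congr rfl fun i _ => ?_
    rw [div_eq_mul_inv, mul_pow, mul_assoc]
  have h7 : ζ j ^ n * (ζ j)⁻¹ ^ n = 1 := by rw [← mul_pow, mul_inv_cancel₀ (hζ0 j), one_pow]
  rw [h6, h5]
  linear_combination c j * h7

/-! ### Kronecker's theorem on orbit closures in tori -/

open UnitAddTorus in
theorem mFourier_add_apply {I : Type*} [Fintype I] (m : I → ℤ) (x y : UnitAddTorus I) :
    mFourier m (x + y) = mFourier m x * mFourier m y := by
  simp [mFourier, fourier_apply, smul_add, AddCircle.toCircle_add, Finset.prod_mul_distrib]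

open UnitAddTorus in
theorem mFourier_nsmul_apply {I : Type*} [Fintype I] (m : I → ℤ) (x : UnitAddTorus I) (n : ℕ) :
    mFourier m (n • x) = mFourier m x ^ n := by
  induction n with
  | zero => simp [mFourier]
  | succ n ih => rw [succ_nsmul, mFourier_add_apply, ih, pow_succ]

open UnitAddTorus in
theorem norm_mFourier_apply {I : Type*} [Fintype I] (m : I → ℤ) (x : UnitAddTorus I) :
    ‖mFourier m x‖ = 1 := by
  simp only [mFourier, ContinuousMap.coe_mk, norm_prod, fourier_apply]
  exact Finset.prod_eq_one fun b _ => Circle.norm_coe _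

open UnitAddTorus in
-- For a character trivial at `θ` the difference vanishes identically; for any other it is a
-- multiple of a nontrivial geometric sequence. Density of trigonometric polynomials gives the
-- general case.
theorem meanZero_sub_translate {I : Type*} [Fintype I] (θ x : UnitAddTorus I)
    (h : ∀ m, mFourier m θ = 1 → mFourier m x = 1) (P : C(UnitAddTorus I, ℂ)) :
    MeanZero fun n => P (n • θ) - P (x + n • θ) := by
  have hspan : ∀ Q ∈ Submodule.span ℂ (Set.range (mFourier (d := I))),
      MeanZero fun n => Q (n • θ) - Q (x + n • θ) := by
    intro Q hQ
    induction hQ using Submodule.span_induction with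
    | mem Q hQ =>
      obtain ⟨m, rfl⟩ := hQ
      by_cases hm : mFourier m θ = 1
      · simp only [mFourier_add_apply, h m hm, one_mul, sub_self]
        exact .of_tendsto tendsto_const_nhds
      · convert (MeanZero.geometric (norm_mFourier_apply m θ) hm).const_mul
          (1 - mFourier m x) using 2 with n
        rw [mFourier_add_apply, mFourier_nsmul_apply]
        ring
    | zero =>
      simp only [ContinuousMap.zero_apply, sub_self]
      exact .of_tendsto tendsto_const_nhds
    | add Q Q' _ _ h1 h2 =>
      convert h1.add h2 using 2 with n
      simp only [ContinuousMap.add_apply]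
      ring
    | smul a Q _ h1 =>
      convert h1.const_mul a using 2 with n
      simp only [ContinuousMap.smul_apply, smul_eq_mul]
      ring
  refine MeanZero.of_approx fun ε hε => ?_
  have hP : P ∈ closure (Submodule.span ℂ (Set.range (mFourier (d := I))) : Set _) := by
    rw [← Submodule.topologicalClosure_coe, span_mFourier_closure_eq_top]
    trivial
  obtain ⟨Q, hQ, hPQ⟩ := Metric.mem_closure_iff.1 hP (ε / 2) (half_pos hε)
  refine ⟨_, hspan Q hQ, fun n => ?_⟩
  have hle : ∀ y, ‖P y - Q y‖ ≤ ε / 2 := fun y => by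
    rw [← ContinuousMap.sub_apply]
    exact ((P - Q).norm_coe_le_norm y).trans (by rw [← dist_eq_norm]; exact hPQ.le)
  calc ‖P (n • θ) - P (x + n • θ) - (Q (n • θ) - Q (x + n • θ))‖
      = ‖(P (n • θ) - Q (n • θ)) - (P (x + n • θ) - Q (x + n • θ))‖ := by ring_nf
    _ ≤ ε / 2 + ε / 2 := (norm_sub_le _ _).trans (add_le_add (hle _) (hle _))
    _ = ε := add_halves ε

open UnitAddTorus in
theorem mem_closure_zmultiples_of_mFourier {I : Type*} [Fintype I] (θ x : UnitAddTorus I)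
    (h : ∀ m, mFourier m θ = 1 → mFourier m x = 1) :
    x ∈ (AddSubgroup.zmultiples θ).topologicalClosure := by
  by_contra hx
  set H := (AddSubgroup.zmultiples θ).topologicalClosure with hH
  have hHc : IsClosed (H : Set (UnitAddTorus I)) := AddSubgroup.isClosed_topologicalClosure _
  have hθ : ∀ n : ℕ, n • θ ∈ H := fun n => H.nsmul_mem
    (AddSubgroup.le_topologicalClosure _ (AddSubgroup.mem_zmultiples θ)) n
  have hKc : IsClosed ((fun y => y - x) ⁻¹' (H : Set (UnitAddTorus I))) :=
    hHc.preimage (by fun_prop)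
  -- If `x` were outside `H`, a Urysohn function could separate `H` from its translate by `x`. Its
  -- two orbit averages would be 0 and 1, although they must agree asymptotically.
  obtain ⟨f, hf0, hf1, -⟩ := exists_continuous_zero_one_of_isClosed hHc hKc (by
    rw [Set.disjoint_left]
    intro y hy hy'
    refine hx ?_
    have := H.sub_mem hy hy'
    simpa using this)
  have key := meanZero_sub_translate θ x h ⟨fun y => (f y : ℂ), by fun_prop⟩
  have : ∀ n : ℕ, ((f (n • θ) : ℂ)) - (f (x + n • θ) : ℂ) = -1 := fun n => by
    rw [hf0 (hθ n), hf1 (show x + n • θ - x ∈ H by simpa using hθ n)]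
    simp
  simp only [ContinuousMap.coe_mk, this] at key
  simpa using key.of_const

theorem nonneg_of_eventually_nonneg_orbit {I : Type*} [Fintype I] {ζ z : I → ℂ}
    (hζ : ∀ i, ‖ζ i‖ = 1) (hz : ∀ i, ‖z i‖ = 1)
    (hrel : ∀ m : I → ℤ, ∏ i, ζ i ^ m i = 1 → ∏ i, z i ^ m i = 1)
    {f : (I → ℂ) → ℝ} (hf : Continuous f) (h : ∀ᶠ n : ℕ in atTop, 0 ≤ f fun i => ζ i ^ n) :
    0 ≤ f z := by
  have hsurj : ∀ w : ℂ, ‖w‖ = 1 → ∃ x : UnitAddCircle, (AddCircle.toCircle x : ℂ) = w := by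
    intro w hw
    obtain ⟨x, hx⟩ := (AddCircle.homeomorphCircle (T := 1) one_ne_zero).surjective
      ⟨w, mem_sphere_zero_iff_norm.2 hw⟩
    rw [AddCircle.homeomorphCircle_apply] at hx
    exact ⟨x, by rw [hx]⟩
  choose θ hθ using fun i => hsurj (ζ i) (hζ i)
  choose x hx using fun i => hsurj (z i) (hz i)
  have hmem := mem_closure_zmultiples_of_mFourier (I := I) θ x fun m hm => by
    simp only [UnitAddTorus.mFourier, ContinuousMap.coe_mk, fourier_apply,
      AddCircle.toCircle_zsmul, Circle.coe_zpow, hθ, hx] at hm ⊢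
    exact hrel m hm
  -- In a compact group the forward multiples return arbitrarily late to every point of the closed
  -- subgroup they generate, so eventual nonnegativity reaches the limit point.
  rw [← mapClusterPt_atTop_nsmul_iff_mem_topologicalClosure_zmultiples] at hmem
  set T : UnitAddTorus I → ℝ := fun y => f fun i => (AddCircle.toCircle (y i) : ℂ) with hT
  have hTc : Continuous T := hf.comp (continuous_pi fun i =>
    continuous_subtype_val.comp (AddCircle.continuous_toCircle.comp (continuous_apply i)))
  have hTx : T x = f z := by simp only [hT, hx]
  have hTn : ∀ n : ℕ, T (n • θ) = f fun i => ζ i ^ n := fun n => by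
    simp only [hT, Pi.smul_apply, AddCircle.toCircle_nsmul, Circle.coe_pow, hθ]
  by_contra! hneg
  rw [← hTx] at hneg
  have hnhds : {y | T y < 0} ∈ 𝓝 x := (isOpen_lt hTc continuous_const).mem_nhds hneg
  obtain ⟨n, hn, hn'⟩ := ((hmem.frequently hnhds).and_eventually h).exists
  rw [← hTn] at hn'
  exact not_lt.2 hn' hn

/-! ### Dominant terms and eventual nonnegativity -/

theorem tendsto_choose_div_choose {k K : ℕ} (h : k < K) :
    Tendsto (fun n : ℕ => (n.choose k : ℂ) / (n.choose K : ℂ)) atTop (𝓝 0) := by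
  have h1 : (fun n : ℕ => (n.choose k : ℝ)) =o[atTop] fun n : ℕ => (n.choose K : ℝ) := by
    have h2 : (fun n : ℕ => (n : ℝ) ^ k) =o[atTop] fun n : ℕ => (n : ℝ) ^ K :=
      (Asymptotics.isLittleO_pow_pow_atTop_of_lt h).comp_tendsto tendsto_natCast_atTop_atTop
    exact ((isTheta_choose k).trans_isLittleO h2).trans_isTheta (isTheta_choose K).symm
  have h2 := h1.tendsto_div_nhds_zero
  have h3 := (Complex.continuous_ofReal.tendsto 0).comp h2
  simpa [Function.comp_def] using h3

theorem tendsto_sub_leading {I : Type*} [Fintype I] {ζ : I → ℂ} (hnorm : ∀ i, ‖ζ i‖ = 1)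
    {D K : ℕ} (hK : K < D) {c : I → ℕ → ℂ} (hc : ∀ j < D, K < j → ∀ i, c i j = 0) {s : ℕ → ℝ}
    (hs : ∀ n, (s n : ℂ) = ∑ i, ∑ k ∈ Finset.range D, c i k * (n.choose k : ℂ) * ζ i ^ n) :
    Tendsto (fun n => ((s n / (n.choose K : ℝ) : ℝ) : ℂ) - ∑ i, c i K * ζ i ^ n) atTop (𝓝 0) := by
  have hterm : ∀ i, ∀ k ∈ (Finset.range D).erase K,
      Tendsto (fun n : ℕ => c i k * ζ i ^ n * ((n.choose k : ℂ) / (n.choose K : ℂ)))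
        atTop (𝓝 0) := by
    intro i k hk
    obtain ⟨hkK, hkD⟩ := Finset.mem_erase.1 hk
    rcases lt_or_gt_of_ne hkK with hlt | hgt
    · have h0 := (tendsto_zero_iff_norm_tendsto_zero.1 (tendsto_choose_div_choose hlt)).const_mul
        ‖c i k‖
      rw [mul_zero] at h0
      refine squeeze_zero_norm (fun n => ?_) h0
      rw [norm_mul, norm_mul, norm_pow, hnorm, one_pow, mul_one]
    · simp [hc k (Finset.mem_range.1 hkD) hgt i]
  have hsum := tendsto_finsetSum Finset.univ fun i (_ : i ∈ Finset.univ) =>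
    tendsto_finsetSum _ (hterm i)
  simp only [Finset.sum_const_zero] at hsum
  refine hsum.congr' ?_
  filter_upwards [eventually_ge_atTop K] with n hn
  have hne : (n.choose K : ℂ) ≠ 0 := by exact_mod_cast (Nat.choose_pos hn).ne'
  rw [Complex.ofReal_div, hs, Complex.ofReal_natCast, Finset.sum_div, ← Finset.sum_sub_distrib]
  refine Finset.sum_congr rfl fun i _ => ?_
  rw [← Finset.add_sum_erase _ _ (Finset.mem_range.2 hK), add_div, Finset.sum_div]
  have : c i K * (n.choose K : ℂ) * ζ i ^ n / (n.choose K : ℂ) = c i K * ζ i ^ n := by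
    field_simp
  rw [this, add_sub_cancel_left]
  refine Finset.sum_congr rfl fun k _ => ?_
  ring

theorem eventually_nonneg_iff {I : Type*} [Fintype I] {ζ : I → ℂ} (hinj : Function.Injective ζ)
    (hnorm : ∀ i, ‖ζ i‖ = 1) (i₀ : I) (hi₀ : ζ i₀ = 1) {D : ℕ} (hD : 0 < D) {c : I → ℕ → ℂ}
    (hc : ∀ k, 0 < k → c i₀ k = 0 ∨ ∀ i, i ≠ i₀ → c i k = 0) {s : ℕ → ℝ}
    (hs : ∀ n, (s n : ℂ) = ∑ i, ∑ k ∈ Finset.range D, c i k * (n.choose k : ℂ) * ζ i ^ n) :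
    (∀ᶠ n in atTop, 0 ≤ s n) ↔
      (∃ k : Fin D, 0 < (k : ℕ) ∧ (∀ j : Fin D, k < j → ∀ i, c i j = 0) ∧ 0 < (c i₀ k).re) ∨
      ((∀ j : Fin D, 0 < (j : ℕ) → ∀ i, c i j = 0) ∧ ∀ z : I → ℂ, (∀ i, ‖z i‖ = 1) →
        (∀ m : I → ℤ, ∏ i, ζ i ^ m i = 1 → ∏ i, z i ^ m i = 1) →
          0 ≤ (∑ i, c i 0 * z i).re) := by
  have hreal : ∀ k : Fin D, (∀ j : Fin D, k < j → ∀ i, c i j = 0) → (∀ i, i ≠ i₀ → c i k = 0) →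
      Tendsto (fun n => ((s n / (n.choose k : ℝ) : ℝ) : ℂ)) atTop (𝓝 (c i₀ k)) := by
    intro k hk hk0
    have h1 := tendsto_sub_leading hnorm k.2 (fun j hj hkj => hk ⟨j, hj⟩ hkj) hs
    have h2 : ∀ n, ∑ i, c i k * ζ i ^ n = c i₀ k := fun n => by
      rw [Finset.sum_eq_single i₀ (fun i _ hi => by rw [hk0 i hi, zero_mul]) (by simp), hi₀]
      simp
    simp only [h2] at h1
    simpa using h1.add_const (c i₀ k)
  have hconst : (∀ j : Fin D, 0 < (j : ℕ) → ∀ i, c i j = 0) →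
      ∀ n, s n = (∑ i, c i 0 * ζ i ^ n).re := by
    intro h0 n
    rw [← Complex.ofReal_re (s n), hs]
    congr 1
    refine Finset.sum_congr rfl fun i _ => ?_
    rw [Finset.sum_eq_single 0]
    · simp
    · intro k hk hk0
      rw [h0 ⟨k, Finset.mem_range.1 hk⟩ (Nat.pos_of_ne_zero hk0) i, zero_mul, zero_mul]
    · exact fun h => absurd (Finset.mem_range.2 hD) h
  constructor
  · intro hev
    by_cases h0 : ∀ j : Fin D, 0 < (j : ℕ) → ∀ i, c i j = 0
    · refine Or.inr ⟨h0, fun z hz hrel => ?_⟩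
      refine nonneg_of_eventually_nonneg_orbit (f := fun z => (∑ i, c i 0 * z i).re) hnorm hz hrel
        (by fun_prop) ?_
      filter_upwards [hev] with n hn
      rwa [← hconst h0 n]
    · left
      push Not at h0
      obtain ⟨k, hkmax⟩ := Set.Finite.exists_maximal
        (Set.toFinite {j : Fin D | 0 < (j : ℕ) ∧ ∃ i, c i j ≠ 0}) h0
      obtain ⟨⟨hkpos, i, hi⟩, hmax⟩ := hkmax
      have hk : ∀ j : Fin D, k < j → ∀ i, c i j = 0 := by
        intro j hj i
        by_contra hne
        exact not_le.2 hj (hmax ⟨hkpos.trans hj, i, hne⟩ hj.le)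
      have hdiv : ∀ᶠ n in atTop, 0 ≤ s n / (n.choose k : ℝ) := hev.mono fun n hn => by positivity
      refine ⟨k, hkpos, hk, ?_⟩
      -- Either the top level has no constant term, and then all its coefficients vanish, contrary
      -- to the choice of `k`; or only the constant survives, and it is a real nonnegative limit.
      rcases hc k hkpos with h1 | h1
      · refine absurd ?_ hi
        refine eq_zero_of_eventually_nonneg (c := fun i => c i k) hinj hnorm (fun j hj => ?_)
          (tendsto_sub_leading hnorm k.2 (fun j hj hkj => hk ⟨j, hj⟩ hkj) hs) hdiv i
        obtain rfl : j = i₀ := hinj (hj.trans hi₀.symm)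
        exact h1
      · have hlim := hreal k hk h1
        have hre := (Complex.continuous_re.tendsto _).comp hlim
        have him := (Complex.continuous_im.tendsto _).comp hlim
        simp only [Function.comp_def, Complex.ofReal_re, Complex.ofReal_im] at hre him
        have h2 : 0 ≤ (c i₀ k).re := ge_of_tendsto hre hdiv
        have h3 : (c i₀ k).im = 0 := tendsto_nhds_unique him tendsto_const_nhds
        refine lt_of_le_of_ne h2 fun h4 => hi ?_
        by_cases hii : i = i₀
        · rw [hii]
          exact Complex.ext h4.symm h3
        · exact h1 i hii
  · rintro (⟨k, hkpos, hk, hre⟩ | ⟨h0, hz⟩)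
    · have h1 : ∀ i, i ≠ i₀ → c i k = 0 := (hc k hkpos).resolve_left fun h => by simp [h] at hre
      have hlim := (Complex.continuous_re.tendsto _).comp (hreal k hk h1)
      simp only [Function.comp_def, Complex.ofReal_re] at hlim
      filter_upwards [hlim.eventually (lt_mem_nhds hre)] with n hn
      by_contra! hneg
      exact not_lt.2 (div_nonpos_of_nonpos_of_nonneg hneg.le (Nat.cast_nonneg _)) hn
    · refine Eventually.of_forall fun n => ?_
      rw [hconst h0 n]
      -- Every point of the orbit satisfies the multiplicative relations of `ζ`, so nonnegativity on
      -- the subgroup covers all `n`.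
      refine hz _ (fun i => by rw [norm_pow, hnorm, one_pow]) fun m hm => ?_
      have : ∀ i, (ζ i ^ n) ^ m i = (ζ i ^ m i) ^ n := fun i => by
        rw [← zpow_natCast, ← zpow_natCast, zpow_comm]
      simp only [this, Finset.prod_pow, hm, one_pow]

/-! ### Orbit closures as algebraic sets -/

theorem exists_finite_relations {I : Type*} [Fintype I] {ζ : I → ℂ}
    (hζ : ∀ i, ζ i ≠ 0) : ∃ M : Finset (I → ℤ), (∀ m ∈ M, ∏ i, ζ i ^ m i = 1) ∧
      ∀ z : I → ℂ, (∀ i, z i ≠ 0) → (∀ m ∈ M, ∏ i, z i ^ m i = 1) →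
        ∀ m : I → ℤ, ∏ i, ζ i ^ m i = 1 → ∏ i, z i ^ m i = 1 := by
  let rel : (z : I → ℂ) → (∀ i, z i ≠ 0) → Submodule ℤ (I → ℤ) := fun z hz =>
    AddSubgroup.toIntSubmodule
    { carrier := {m | ∏ i, z i ^ m i = 1}
      zero_mem' := by simp
      add_mem' := fun {m m'} hm hm' => by
        simp only [Set.mem_ofPred_eq, Pi.add_apply] at hm hm' ⊢
        simp only [zpow_add₀ (hz _), Finset.prod_mul_distrib, hm, hm', one_mul]
      neg_mem' := fun {m} hm => by
        simp only [Set.mem_ofPred_eq, Pi.neg_apply] at hm ⊢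
        simp only [zpow_neg, Finset.prod_inv_distrib, hm, inv_one] }
  -- Multiplicative relations form a subgroup of a finitely generated free abelian group, so
  -- finitely many of them imply the rest.
  obtain ⟨M, hM⟩ := (inferInstance : IsNoetherian ℤ (I → ℤ)).noetherian (rel ζ hζ)
  refine ⟨M, fun m hm => ?_, fun z hz hMz m hm => ?_⟩
  · have : m ∈ rel ζ hζ := hM ▸ Submodule.subset_span hm
    exact this
  · have h1 : m ∈ rel ζ hζ := hm
    have h2 : Submodule.span ℤ (M : Set (I → ℤ)) ≤ rel z hz :=
      Submodule.span_le.2 fun m hm => hMz m hm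
    exact h2 (hM ▸ h1)

namespace IsAlgPolynomial

theorem comp_index {ι κ : Type} {f : (ι → ℝ) → ℝ} (hf : IsAlgPolynomial f) (e : ι → κ) :
    IsAlgPolynomial fun v : κ → ℝ => f (v ∘ e) := by
  induction hf with
  | coord i => exact .coord (e i)
  | const ha => exact .const ha
  | add _ _ h1 h2 => exact h1.add h2
  | mul _ _ h1 h2 => exact h1.mul h2

end IsAlgPolynomial

namespace IsComplexAlgPolynomial

theorem comp_index {ι κ : Type} {f : (ι → ℝ) → ℂ} (hf : IsComplexAlgPolynomial f) (e : ι → κ) :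
    IsComplexAlgPolynomial fun v : κ → ℝ => f (v ∘ e) :=
  ⟨hf.re.comp_index e, hf.im.comp_index e⟩

theorem conj {ι : Type} {f : (ι → ℝ) → ℂ} (hf : IsComplexAlgPolynomial f) :
    IsComplexAlgPolynomial fun v => starRingEnd ℂ (f v) :=
  ⟨by simpa using hf.re, by simpa using hf.im.neg⟩

end IsComplexAlgPolynomial

/-- On the unit circle inversion is conjugation, which makes relations with negative exponents
polynomial in real and imaginary parts. -/
theorem zpow_eq_of_norm_eq_one {z : ℂ} (hz : ‖z‖ = 1) (m : ℤ) :
    z ^ m = z ^ m.toNat * starRingEnd ℂ z ^ (-m).toNat := by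
  cases m with
  | ofNat n => simp
  | negSucc n =>
    rw [zpow_negSucc, ← inv_pow, Complex.inv_eq_conj hz]
    simp [Int.neg_negSucc]

/-- The linear forms that are nonnegative on the closure of an orbit in a torus form a
semialgebraic set. -/
theorem signDetermined_torus_nonneg {ι I : Type} [Fintype I] {ζ : I → ℂ} (hζ : ∀ i, ζ i ≠ 0)
    {c : I → (ι → ℝ) → ℂ} (hc : ∀ i, IsComplexAlgPolynomial (c i)) :
    SignDetermined {x : ι → ℝ | ∀ z : I → ℂ, (∀ i, ‖z i‖ = 1) →
      (∀ m : I → ℤ, ∏ i, ζ i ^ m i = 1 → ∏ i, z i ^ m i = 1) →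
        0 ≤ (∑ i, c i x * z i).re} := by
  obtain ⟨M, hM, hM'⟩ := exists_finite_relations hζ
  let Z : (ι ⊕ (I × Bool) → ℝ) → I → ℂ := fun v i =>
    ⟨v (Sum.inr (i, false)), v (Sum.inr (i, true))⟩
  have hZ : ∀ i, IsComplexAlgPolynomial fun v => Z v i := fun i => .mk_coord _ _
  have h1 : SignDetermined {v | ∀ i, ‖Z v i‖ = 1} :=
    .forall_finite fun i => (hZ i).signDetermined_norm_eq_one
  have h2 : SignDetermined {v | ∀ m : M,
      ∏ i, (Z v i ^ (m.1 i).toNat * starRingEnd ℂ (Z v i) ^ (-m.1 i).toNat) = 1} :=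
    .forall_finite fun m => IsComplexAlgPolynomial.signDetermined_eq
      (.prod _ fun i _ => ((hZ i).pow _).mul ((hZ i).conj.pow _)) (.const isAlgebraic_one)
  have h3 : SignDetermined {v | 0 ≤ (∑ i, c i (v ∘ Sum.inl) * Z v i).re} :=
    IsAlgPolynomial.signDetermined_nonneg
      (IsComplexAlgPolynomial.sum _ fun i _ => ((hc i).comp_index Sum.inl).mul (hZ i)).re
  convert (h1.imp (h2.imp h3)).forall_pi using 1
  ext x
  have hZx : ∀ y i, Z (Sum.elim x y) i = ⟨y (i, false), y (i, true)⟩ := fun y i => rfl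
  simp only [Set.mem_ofPred_eq, Sum.elim_comp_inl, hZx]
  constructor
  · intro h y hy hrel
    refine h _ hy (hM' _ (fun i hi => ?_) fun m hm => ?_)
    · have := hy i
      rw [hi, norm_zero] at this
      exact zero_ne_one this
    · rw [← hrel ⟨m, hm⟩]
      exact Finset.prod_congr rfl fun i _ => zpow_eq_of_norm_eq_one (hy i) _
  · intro h z hz hrel
    refine h (fun p => if p.2 then (z p.1).im else (z p.1).re) (fun i => ?_) fun m => ?_
    · simpa using hz i
    · rw [← hrel m (hM m m.2)]
      exact Finset.prod_congr rfl fun i _ => (zpow_eq_of_norm_eq_one (hz i) _).symm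

end Semialgebraic

namespace LinearLoop

open Filter Topology Polynomial

variable {d : ℕ} (A : Matrix (Fin d) (Fin d) ℤ) (b : Fin d → ℤ)

/-! ### Eigenvalues and their indices -/

theorem mem_eigenvalues_iff (z : ℂ) :
    z ∈ eigenvalues A ↔ (minpoly ℂ (complexMatrix A)).IsRoot z := by
  rw [← Matrix.minpoly_toLin']
  exact Module.End.hasEigenvalue_iff_isRoot

theorem finite_eigenvalues : (eigenvalues A).Finite :=
  Module.End.finite_hasEigenvalue _

theorem isAlgebraic_of_mem_eigenvalues {z : ℂ} (hz : z ∈ eigenvalues A) : IsAlgebraic ℚ z := by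
  have h1 : (Matrix.charpoly (complexMatrix A)).IsRoot z := by
    rw [← Matrix.charpoly_toLin', ← Module.End.hasEigenvalue_iff_isRoot_charpoly]
    exact hz
  have h2 : complexMatrix A = A.map (Int.castRingHom ℂ) := rfl
  rw [h2, Matrix.charpoly_map, IsRoot, eval_map] at h1
  have h3 : IsIntegral ℤ z := ⟨A.charpoly, A.charpoly_monic, h1⟩
  exact h3.tower_top.isAlgebraic

theorem minpoly_ne_zero : minpoly ℂ (complexMatrix A) ≠ 0 :=
  minpoly.ne_zero (Algebra.IsIntegral.isIntegral _)

theorem index_pos_iff (z : ℂ) : 0 < index A z ↔ z ∈ eigenvalues A := by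
  rw [mem_eigenvalues_iff]
  exact rootMultiplicity_pos (minpoly_ne_zero A)

theorem index_le_index_conj (z : ℂ) : index A z ≤ index A (starRingEnd ℂ z) := by
  have hA : (starRingEnd ℂ).mapMatrix (complexMatrix A) = complexMatrix A := by
    ext i j
    simp [complexMatrix]
  have h0 : aeval (complexMatrix A) ((minpoly ℂ (complexMatrix A)).map (starRingEnd ℂ)) = 0 := by
    rw [aeval_def, eval₂_map]
    have h1 := congrArg (starRingEnd ℂ).mapMatrix (minpoly.aeval ℂ (complexMatrix A))
    rw [map_zero, aeval_def, hom_eval₂, hA] at h1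
    rw [← h1]
    congr 1
    ext a i j
    by_cases hij : i = j <;> simp [Matrix.algebraMap_matrix_apply, hij]
  have hdvd := minpoly.dvd ℂ _ h0
  have hne : (minpoly ℂ (complexMatrix A)).map (starRingEnd ℂ) ≠ 0 :=
    (Polynomial.map_ne_zero_iff (starRingEnd ℂ).injective).2 (minpoly_ne_zero A)
  have h2 := rootMultiplicity_le_rootMultiplicity_of_dvd hne hdvd (starRingEnd ℂ (starRingEnd ℂ z))
  rw [← eq_rootMultiplicity_map (starRingEnd ℂ).injective, Complex.conj_conj] at h2
  exact h2

theorem sum_index_le (s : Finset ℂ) : ∑ z ∈ s, index A z ≤ d := by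
  calc ∑ z ∈ s, index A z = ∑ z ∈ s, (minpoly ℂ (complexMatrix A)).roots.count z := by
        simp only [count_roots, index]
    _ ≤ Multiset.card (minpoly ℂ (complexMatrix A)).roots :=
        (Finset.sum_le_sum_of_subset Finset.subset_union_left).trans
          (Multiset.sum_count_eq_card (s := s ∪ (minpoly ℂ (complexMatrix A)).roots.toFinset)
            fun z hz => Finset.mem_union_right _ (Multiset.mem_toFinset.2 hz)).le
    _ ≤ (minpoly ℂ (complexMatrix A)).natDegree := card_roots' _
    _ ≤ (complexMatrix A).charpoly.natDegree :=
        natDegree_le_of_dvd (Matrix.minpoly_dvd_charpoly _) (Matrix.charpoly_monic _).ne_zero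
    _ = d := by rw [Matrix.charpoly_natDegree_eq_dim, Fintype.card_fin]

/-- Write the minimal polynomial as a power of `X - C z` times `q` coprime to it. The vector is
annihilated by `(X - C z) ^ k` and by `(X - C z) * q`, and a Bézout identity puts `X - C z` in the
ideal they generate. -/
theorem apply_eq_zero_of_index_le_one {z : ℂ} (hz : index A z ≤ 1) {w : Fin d → ℂ} {k : ℕ}
    (hw : ((Matrix.toLin' (complexMatrix A) - z • 1) ^ k) w = 0) :
    (Matrix.toLin' (complexMatrix A) - z • 1) w = 0 := by
  set f := Matrix.toLin' (complexMatrix A) with hf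
  obtain ⟨q, hq, hnd⟩ := exists_eq_pow_rootMultiplicity_mul_and_not_dvd _ (minpoly_ne_zero A) z
  have hcop : IsCoprime ((X - C z) ^ k) q :=
    (((irreducible_X_sub_C z).coprime_iff_not_dvd).2 hnd).pow_left
  obtain ⟨u, v, huv⟩ := hcop
  have hX : aeval f (X - C z) = f - z • 1 := by
    rw [map_sub, aeval_X, aeval_C, Algebra.algebraMap_eq_smul_one]
  have hdvd : minpoly ℂ f ∣ (X - C z) * q := by
    rw [hf, Matrix.minpoly_toLin', hq]
    exact mul_dvd_mul_right (pow_dvd_pow (X - C z) hz |>.trans (by rw [pow_one])) q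
  have h0 : aeval f ((X - C z) * q) = 0 := by
    obtain ⟨p, hp⟩ := hdvd
    rw [hp, map_mul, minpoly.aeval, zero_mul]
  have h1 : (X - C z) = (X - C z) * u * (X - C z) ^ k + v * ((X - C z) * q) := by
    linear_combination (-(X - C z)) * huv
  rw [← hX, h1, map_add, map_mul _ v, h0, mul_zero, add_zero, map_mul, Module.End.mul_apply,
    map_pow, hX, hw, map_zero]

/-- Suppose `r` and another `z` of modulus `r` both have index at least two. Non-degeneracy excludes
`z = -r`, since the quotient would be -1, so `z` is not real. Then `r`, `z` and the conjugate of `z`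
account for total index at least 6, impossible for `d ≤ 5`; the other two hypotheses are
contradicted directly. -/
theorem index_le_one_or {r : ℝ} (hr : 0 < r) (hA : NonDegenerate A)
    (hcases : d ≤ 5 ∨ (∀ ρ : ℝ, 0 < ρ → (ρ : ℂ) ∉ modulusClass A r) ∨
      (∀ z ∈ modulusClass A r, z.im ≠ 0 → index A z = 1)) :
    index A r ≤ 1 ∨ ∀ z ∈ modulusClass A r, z ≠ r → index A z ≤ 1 := by
  by_contra! hcon
  obtain ⟨hr2, z, hz, hzr, hz2⟩ := hcon
  have hre : (r : ℂ) ∈ eigenvalues A := (index_pos_iff A r).1 (by omega)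
  have hrm : (r : ℂ) ∈ modulusClass A r := ⟨hre, by simp [abs_of_pos hr]⟩
  have hr0 : (r : ℂ) ≠ 0 := by exact_mod_cast hr.ne'
  have him : z.im ≠ 0 := by
    intro him
    have hzre : z = (z.re : ℂ) := Complex.ext rfl (by simpa using him)
    refine hA z hz.1 r hre hzr 2 two_pos ?_
    have h1 := hz.2
    rw [hzre, Complex.norm_real, Real.norm_eq_abs] at h1
    have h2 : z.re ^ 2 = r ^ 2 := by rw [← sq_abs, h1]
    rw [div_pow, div_eq_one_iff_eq (pow_ne_zero 2 hr0), hzre]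
    exact_mod_cast h2
  rcases hcases with h5 | h | h
  · have hc2 : 1 < index A (starRingEnd ℂ z) := hz2.trans_le (index_le_index_conj A z)
    have hzc : z ≠ starRingEnd ℂ z := fun h => him (Complex.conj_eq_iff_im.1 h.symm)
    have hrc : (r : ℂ) ≠ starRingEnd ℂ z := fun h => him (by
      have := congrArg Complex.im h
      simpa using this.symm)
    have hsum := sum_index_le A {(r : ℂ), z, starRingEnd ℂ z}
    rw [Finset.sum_insert (by simp [hzr.symm, hrc]), Finset.sum_insert (by simpa using hzc),
      Finset.sum_singleton] at hsum
    omega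
  · exact h r hr hrm
  · have := h z hz him
    omega

end LinearLoop

namespace LinearLoop

open Filter Topology Semialgebraic

variable {d : ℕ} (A : Matrix (Fin d) (Fin d) ℤ) (b : Fin d → ℤ)

/-! ### Orbits -/

/-- The linear form of the loop guard on complex vectors. -/
noncomputable def guardForm : (Fin d → ℂ) →ₗ[ℂ] ℂ :=
  ∑ j, (b j : ℂ) • LinearMap.proj j

theorem guardForm_apply (v : Fin d → ℂ) : guardForm b v = ∑ j, (b j : ℂ) * v j := by
  simp [guardForm]

theorem realToComplex_body (x : Fin d → ℝ) :
    realToComplex d (body A x) = Matrix.toLin' (complexMatrix A) (realToComplex d x) := by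
  ext j
  simp [realToComplex, body, complexMatrix, Matrix.mulVec, dotProduct]

theorem realToComplex_iterate_body (x : Fin d → ℝ) (n : ℕ) :
    realToComplex d ((body A)^[n] x) =
      (Matrix.toLin' (complexMatrix A) ^ n) (realToComplex d x) := by
  induction n with
  | zero => simp
  | succ n ih =>
    rw [Function.iterate_succ_apply', realToComplex_body, ih, pow_succ', Module.End.mul_apply]

theorem ofReal_guard_iterate (x : Fin d → ℝ) (n : ℕ) :
    ((∑ j, (b j : ℝ) * (body A)^[n] x j : ℝ) : ℂ) =
      guardForm b ((Matrix.toLin' (complexMatrix A) ^ n) (realToComplex d x)) := by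
  rw [← realToComplex_iterate_body, guardForm_apply]
  simp [realToComplex]

theorem mem_ENT_iff (x : Fin d → ℝ) :
    x ∈ ENT (body A) (guard b) ↔ ∀ᶠ n in atTop, 0 ≤ ∑ j, (b j : ℝ) * (body A)^[n] x j := by
  rw [eventually_atTop]
  constructor
  · rintro ⟨N, hN⟩
    refine ⟨N, fun n hn => ?_⟩
    have := hN (n - N)
    rw [← Function.iterate_add_apply, Nat.sub_add_cancel hn] at this
    exact this
  · rintro ⟨N, hN⟩
    refine ⟨N, fun n => ?_⟩
    rw [← Function.iterate_add_apply]
    exact hN _ (Nat.le_add_left _ _)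

/-! ### Generalised eigenvectors -/

/-- The eigenvalues of modulus `r`, together with `r` itself. -/
noncomputable def spectralIndex (r : ℝ) : Finset ℂ :=
  insert (r : ℂ) ((finite_eigenvalues A).subset
    (show modulusClass A r ⊆ eigenvalues A from fun _ h => h.1)).toFinset

theorem mem_spectralIndex {r : ℝ} {z : ℂ} :
    z ∈ spectralIndex A r ↔ z = r ∨ z ∈ modulusClass A r := by
  simp [spectralIndex]

theorem norm_of_mem_spectralIndex {r : ℝ} (hr : 0 ≤ r) (z : spectralIndex A r) : ‖(z : ℂ)‖ = r := by
  rcases (mem_spectralIndex A).1 z.2 with h | h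
  · rw [h, Complex.norm_real, Real.norm_of_nonneg hr]
  · exact h.2

theorem mem_maxGenEigenspace_iff (z : ℂ) (w : Fin d → ℂ) :
    w ∈ Module.End.maxGenEigenspace (Matrix.toLin' (complexMatrix A)) z ↔
      ((Matrix.toLin' (complexMatrix A) - z • 1) ^ d) w = 0 := by
  rw [Module.End.maxGenEigenspace_eq_genEigenspace_finrank, Module.End.mem_genEigenspace_nat,
    LinearMap.mem_ker, Module.finrank_fin_fun]

/-- Adding `r` to the index set is harmless: if it is not an eigenvalue, its generalised eigenspace
is trivial. Its presence guarantees an index with `ζ = 1`. -/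
theorem iSup_maxGenEigenspace_eq {r : ℝ} (hr : 0 ≤ r) :
    ⨆ z ∈ modulusClass A r, Module.End.maxGenEigenspace (Matrix.toLin' (complexMatrix A)) z =
      ⨆ z : spectralIndex A r,
        Module.End.maxGenEigenspace (Matrix.toLin' (complexMatrix A)) (z : ℂ) := by
  refine le_antisymm (iSup₂_le fun z hz => ?_) (iSup_le fun ⟨z, hz⟩ => ?_)
  · exact le_iSup (fun z : spectralIndex A r =>
      Module.End.maxGenEigenspace (Matrix.toLin' (complexMatrix A)) (z : ℂ))
        ⟨z, (mem_spectralIndex A).2 (Or.inr hz)⟩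
  · by_cases hev : z ∈ eigenvalues A
    · exact le_iSup₂ (f := fun z _ =>
        Module.End.maxGenEigenspace (Matrix.toLin' (complexMatrix A)) z) z
          ⟨hev, norm_of_mem_spectralIndex A hr ⟨z, hz⟩⟩
    · intro w hw
      have hker : ∀ v, (Matrix.toLin' (complexMatrix A) - z • 1) v = 0 → v = 0 := by
        intro v hv
        by_contra hne
        refine hev (Module.End.hasEigenvalue_of_hasEigenvector (x := v) ⟨?_, hne⟩)
        rw [Module.End.mem_eigenspace_iff]
        simpa [sub_eq_zero] using hv
      have : ∀ k : ℕ, ((Matrix.toLin' (complexMatrix A) - z • 1) ^ k) w = 0 → w = 0 := by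
        intro k
        induction k with
        | zero => simp
        | succ k ih =>
          intro h
          rw [pow_succ', Module.End.mul_apply] at h
          exact ih (hker _ h)
      rw [this d ((mem_maxGenEigenspace_iff A z w).1 hw)]
      exact Submodule.zero_mem _

theorem mem_modulusSubspace_iff {r : ℝ} (hr : 0 ≤ r) (x : Fin d → ℝ) :
    x ∈ modulusSubspace A r ↔ ∃ w : spectralIndex A r → Fin d → ℂ,
      (∀ i : spectralIndex A r, ((Matrix.toLin' (complexMatrix A) - (i : ℂ) • 1) ^ d) (w i) = 0) ∧
        ∑ i, w i = realToComplex d x := by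
  have h1 : x ∈ modulusSubspace A r ↔ realToComplex d x ∈ ⨆ z ∈ modulusClass A r,
    Module.End.maxGenEigenspace (Matrix.toLin' (complexMatrix A)) z := Iff.rfl
  rw [h1, iSup_maxGenEigenspace_eq A hr, Submodule.mem_iSup_iff_exists_finsupp]
  simp only [mem_maxGenEigenspace_iff]
  constructor
  · rintro ⟨f, hf, hsum⟩
    exact ⟨f, hf, by rw [← hsum, Finsupp.sum_fintype _ _ fun _ => rfl]⟩
  · rintro ⟨w, hw, hsum⟩
    exact ⟨Finsupp.equivFunOnFinite.symm w, hw,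
      by rw [← hsum, Finsupp.sum_fintype _ _ fun _ => rfl]; rfl⟩

/-- This is the binomial theorem for `f = (f - z) + z`. The range can be cut at `D` because higher
powers kill `w`, and extended to `D` because the binomial coefficients vanish for `k > n`. -/
theorem pow_apply_of_generalized {V : Type*} [AddCommGroup V] [Module ℂ V] (f : Module.End ℂ V)
    {z : ℂ} (hz : z ≠ 0) {w : V} {D : ℕ} (hw : ((f - z • 1) ^ D) w = 0) (n : ℕ) :
    (f ^ n) w = ∑ k ∈ Finset.range D,
      ((n.choose k : ℂ) * z ^ n * (z ^ k)⁻¹) • ((f - z • 1) ^ k) w := by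
  have hzero : ∀ k, D ≤ k → ((f - z • 1) ^ k) w = 0 := fun k hk => by
    rw [← Nat.sub_add_cancel hk, pow_add, Module.End.mul_apply, hw, map_zero]
  have hcomm : Commute (f - z • 1) (z • (1 : Module.End ℂ V)) :=
    (Commute.one_right _).smul_right z
  have h1 : (f ^ n) w = ∑ k ∈ Finset.range (n + 1),
      ((n.choose k : ℂ) * z ^ n * (z ^ k)⁻¹) • ((f - z • 1) ^ k) w := by
    conv_lhs => rw [← sub_add_cancel f (z • 1), hcomm.add_pow, LinearMap.sum_apply]
    refine Finset.sum_congr rfl fun k hk => ?_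
    have hkn : k ≤ n := Nat.lt_succ_iff.1 (Finset.mem_range.1 hk)
    rw [smul_pow, one_pow, mul_smul_comm, mul_one, smul_mul_assoc, ← nsmul_eq_mul',
      LinearMap.smul_apply, LinearMap.smul_apply, ← Nat.cast_smul_eq_nsmul ℂ, smul_smul,
      pow_sub₀ z hz hkn]
    congr 1
    ring
  rw [h1]
  have h2 : ∀ m, ∀ k ∈ Finset.range (max (n + 1) D), k ∉ Finset.range m →
      (m = n + 1 ∨ m = D) →
      ((n.choose k : ℂ) * z ^ n * (z ^ k)⁻¹) • ((f - z • 1) ^ k) w = 0 := by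
    rintro m k - hk (rfl | rfl)
    · rw [Nat.choose_eq_zero_of_lt (by simpa using hk)]
      simp
    · rw [hzero k (by simpa using hk), smul_zero]
  rw [Finset.sum_subset (Finset.range_mono (le_max_left (n + 1) D))
      fun k hk hk' => h2 _ k hk hk' (Or.inl rfl),
    Finset.sum_subset (Finset.range_mono (le_max_right (n + 1) D))
      fun k hk hk' => h2 _ k hk hk' (Or.inr rfl)]

/-- The coefficient of `(n choose k) zⁿ` in the guard values along the orbit of a generalised
eigenvector `w` for `z`. -/
noncomputable def orbitCoeff (z : ℂ) (w : Fin d → ℂ) (k : ℕ) : ℂ :=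
  (z ^ k)⁻¹ * guardForm b (((Matrix.toLin' (complexMatrix A) - z • 1) ^ k) w)

theorem guardForm_pow_eq {r : ℝ} (hr : 0 < r) {w : spectralIndex A r → Fin d → ℂ}
    (hw : ∀ i : spectralIndex A r, ((Matrix.toLin' (complexMatrix A) - (i : ℂ) • 1) ^ d) (w i) = 0)
    (n : ℕ) :
    guardForm b ((Matrix.toLin' (complexMatrix A) ^ n) (∑ i, w i)) = (r : ℂ) ^ n *
      ∑ i : spectralIndex A r, ∑ k ∈ Finset.range d,
        orbitCoeff A b i (w i) k * (n.choose k : ℂ) * ((i : ℂ) / r) ^ n := by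
  have hr0 : (r : ℂ) ≠ 0 := by exact_mod_cast hr.ne'
  rw [map_sum, map_sum, Finset.mul_sum]
  refine Finset.sum_congr rfl fun i _ => ?_
  have hi : (i : ℂ) ≠ 0 := fun h => by
    have := norm_of_mem_spectralIndex A hr.le i
    rw [h, norm_zero] at this
    exact hr.ne this
  rw [pow_apply_of_generalized _ hi (hw i), map_sum, Finset.mul_sum]
  refine Finset.sum_congr rfl fun k _ => ?_
  rw [map_smul, smul_eq_mul, orbitCoeff, div_pow]
  field_simp

/-! ### Semialgebraicity -/

theorem isComplexAlgPolynomial_guardForm {ι : Type} {W : (ι → ℝ) → Fin d → ℂ}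
    (hW : ∀ j, IsComplexAlgPolynomial fun v => W v j) :
    IsComplexAlgPolynomial fun v => guardForm b (W v) := by
  simp only [guardForm_apply]
  exact .sum _ fun j _ => (IsComplexAlgPolynomial.const (isAlgebraic_intCast (R := ℚ) (b j))).mul
    (hW j)

theorem isComplexAlgPolynomial_pow_apply {ι : Type} {W : (ι → ℝ) → Fin d → ℂ}
    (hW : ∀ j, IsComplexAlgPolynomial fun v => W v j) {z : ℂ} (hz : IsAlgebraic ℚ z) (k : ℕ)
    (j : Fin d) : IsComplexAlgPolynomial fun v =>
      ((Matrix.toLin' (complexMatrix A) - z • 1) ^ k) (W v) j := by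
  induction k generalizing j with
  | zero => simpa using hW j
  | succ k ih =>
    simp only [pow_succ', Module.End.mul_apply]
    simp only [LinearMap.sub_apply, Matrix.toLin'_apply, Matrix.mulVec, dotProduct,
      LinearMap.smul_apply, Module.End.one_apply, Pi.sub_apply, Pi.smul_apply, smul_eq_mul,
      complexMatrix, Matrix.map_apply]
    exact (IsComplexAlgPolynomial.sum _ fun l _ => (IsComplexAlgPolynomial.const
      (isAlgebraic_intCast (R := ℚ) (A j l))).mul (ih l)).sub
        ((IsComplexAlgPolynomial.const hz).mul (ih j))

theorem isAlgebraic_of_mem_eigenvalueModuli {r : ℝ} (hr : r ∈ eigenvalueModuli A) :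
    IsAlgebraic ℚ (r : ℂ) := by
  obtain ⟨z, hz, rfl⟩ := hr
  -- The square of the modulus is `z` times its conjugate, a product of algebraic numbers.
  refine IsAlgebraic.of_pow two_pos ?_
  have hz' := isAlgebraic_of_mem_eigenvalues A hz
  have := hz'.mul (Complex.isAlgebraic_conj hz')
  rwa [Complex.mul_conj, Complex.normSq_eq_norm_sq, Complex.ofReal_pow] at this

theorem isAlgebraic_of_mem_spectralIndex {r : ℝ} (hr : r ∈ eigenvalueModuli A)
    (z : spectralIndex A r) : IsAlgebraic ℚ (z : ℂ) := by
  rcases (mem_spectralIndex A).1 z.2 with h | h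
  · rw [h]
    exact isAlgebraic_of_mem_eigenvalueModuli A hr
  · exact isAlgebraic_of_mem_eigenvalues A h.1

/-- The family of complex vectors with the given real and imaginary parts of coordinates. -/
def vectorFamily {ι I : Type} (v : ι ⊕ (I × Fin d × Bool) → ℝ) (i : I) (j : Fin d) : ℂ :=
  ⟨v (Sum.inr (i, j, false)), v (Sum.inr (i, j, true))⟩

/-- The decomposition into generalised eigenvectors is quantified existentially rather than
computed. Its uniqueness is not needed, since `mem_ENT_iff_eventuallyGuarded` holds for any
decomposition. -/
theorem signDetermined_exists_decomposition {r : ℝ} (hr : r ∈ eigenvalueModuli A)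
    (P : (spectralIndex A r → Fin d → ℂ) → Prop)
    (hP : SignDetermined {v : Fin d ⊕ (spectralIndex A r × Fin d × Bool) → ℝ |
      P (vectorFamily v)}) :
    SignDetermined {x : Fin d → ℝ | ∃ w : spectralIndex A r → Fin d → ℂ,
      ((∀ i : spectralIndex A r, ((Matrix.toLin' (complexMatrix A) - (i : ℂ) • 1) ^ d) (w i) = 0) ∧
        ∑ i, w i = realToComplex d x) ∧ P w} := by
  have hW : ∀ i j, IsComplexAlgPolynomial
      fun v : Fin d ⊕ (spectralIndex A r × Fin d × Bool) → ℝ => vectorFamily v i j :=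
    fun i j => .mk_coord _ _
  have h1 : SignDetermined {v : Fin d ⊕ (spectralIndex A r × Fin d × Bool) → ℝ |
      ∀ (i : spectralIndex A r) (j : Fin d),
        ((Matrix.toLin' (complexMatrix A) - (i : ℂ) • 1) ^ d) (vectorFamily v i) j = 0} :=
    .forall_finite fun i => .forall_finite fun j =>
      IsComplexAlgPolynomial.signDetermined_eq (isComplexAlgPolynomial_pow_apply A (hW i)
        (isAlgebraic_of_mem_spectralIndex A hr i) d j) (.const isAlgebraic_zero)
  have h2 : SignDetermined {v : Fin d ⊕ (spectralIndex A r × Fin d × Bool) → ℝ |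
      ∀ j : Fin d, ∑ i : spectralIndex A r, vectorFamily v i j = (v (Sum.inl j) : ℂ)} :=
    .forall_finite fun j => IsComplexAlgPolynomial.signDetermined_eq
      (.sum _ fun i _ => hW i j) (.ofReal (.coord _))
  convert ((h1.and h2).and hP).exists_pi using 1
  ext x
  have hsum : ∀ w : spectralIndex A r → Fin d → ℂ, ∑ i, w i = realToComplex d x ↔
      ∀ j, ∑ i, w i j = (x j : ℂ) := fun w => by
    rw [funext_iff]
    refine forall_congr' fun j => ?_
    rw [Finset.sum_apply]
    rfl
  simp only [Set.mem_ofPred_eq, Sum.elim_inl, hsum]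
  constructor
  · rintro ⟨w, ⟨hw, hw'⟩, hPw⟩
    have hvw : vectorFamily (Sum.elim x fun p : spectralIndex A r × Fin d × Bool =>
        if p.2.2 then (w p.1 p.2.1).im else (w p.1 p.2.1).re) = w := by
      ext i j
      simp [vectorFamily]
    refine ⟨fun p => if p.2.2 then (w p.1 p.2.1).im else (w p.1 p.2.1).re, ?_⟩
    rw [hvw]
    exact ⟨⟨fun i j => by rw [hw i]; rfl, hw'⟩, hPw⟩
  · rintro ⟨y, ⟨hw, hw'⟩, hPw⟩
    exact ⟨_, ⟨fun i => funext (hw i), hw'⟩, hPw⟩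

theorem isSemialgebraic_modulusSubspace {r : ℝ} (hr : r ∈ eigenvalueModuli A) (hr0 : 0 ≤ r) :
    IsSemialgebraic (modulusSubspace A r : Set (Fin d → ℝ)) := by
  have := (signDetermined_exists_decomposition A hr (fun _ => True)
    (SignDetermined.const True)).isSemialgebraic
  convert this using 1
  ext x
  simp only [SetLike.mem_coe, mem_modulusSubspace_iff A hr0, Set.mem_ofPred_eq, and_true]

theorem modulusSubspace_zero_subset_ENT :
    (modulusSubspace A 0 : Set (Fin d → ℝ)) ⊆ ENT (body A) (guard b) := by
  intro x hx
  rw [mem_ENT_iff]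
  filter_upwards [eventually_ge_atTop d] with n hn
  obtain ⟨w, hw, hsum⟩ := (mem_modulusSubspace_iff A le_rfl x).1 hx
  have h0 : (Matrix.toLin' (complexMatrix A) ^ n) (realToComplex d x) = 0 := by
    rw [← hsum, map_sum]
    refine Finset.sum_eq_zero fun i _ => ?_
    have hi : (i : ℂ) = 0 := norm_eq_zero.1 (norm_of_mem_spectralIndex A le_rfl i)
    have := hw i
    rw [hi, zero_smul, sub_zero] at this
    rw [← Nat.sub_add_cancel hn, pow_add, Module.End.mul_apply, this, map_zero]
  have h1 := ofReal_guard_iterate A b x n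
  rw [h0, map_zero, Complex.ofReal_eq_zero] at h1
  exact h1.ge

/-- The condition on a family of generalised eigenvectors that characterises eventual
non-termination from the sum of the family. -/
def EventuallyGuarded (r : ℝ) (w : spectralIndex A r → Fin d → ℂ) : Prop :=
  (∃ k : Fin d, 0 < (k : ℕ) ∧
    (∀ j : Fin d, k < j → ∀ i, orbitCoeff A b i.1 (w i) j = 0) ∧
      0 < (orbitCoeff A b r (w ⟨r, (mem_spectralIndex A).2 (Or.inl rfl)⟩) k).re) ∨
  ((∀ j : Fin d, 0 < (j : ℕ) → ∀ i, orbitCoeff A b i.1 (w i) j = 0) ∧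
    ∀ z : spectralIndex A r → ℂ, (∀ i, ‖z i‖ = 1) →
      (∀ m : spectralIndex A r → ℤ, ∏ i : spectralIndex A r, ((i : ℂ) / r) ^ m i = 1 →
          ∏ i, z i ^ m i = 1) →
        0 ≤ (∑ i, orbitCoeff A b i.1 (w i) 0 * z i).re)

theorem mem_ENT_iff_eventuallyGuarded {r : ℝ} (hr : 0 < r) (hd : 0 < d)
    (hindex : index A r ≤ 1 ∨ ∀ z ∈ modulusClass A r, z ≠ r → index A z ≤ 1)
    {x : Fin d → ℝ} {w : spectralIndex A r → Fin d → ℂ}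
    (hw : ∀ i : spectralIndex A r,
      ((Matrix.toLin' (complexMatrix A) - (i : ℂ) • 1) ^ d) (w i) = 0)
    (hsum : ∑ i, w i = realToComplex d x) :
    x ∈ ENT (body A) (guard b) ↔ EventuallyGuarded A b r w := by
  have hr0 : (r : ℂ) ≠ 0 := by exact_mod_cast hr.ne'
  have hsimple : ∀ i : spectralIndex A r, index A i ≤ 1 → ∀ k, 0 < k →
      orbitCoeff A b i (w i) k = 0 := by
    intro i hi k hk
    obtain ⟨k, rfl⟩ := Nat.exists_eq_succ_of_ne_zero hk.ne'
    rw [orbitCoeff, pow_succ (_ - _), Module.End.mul_apply,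
      apply_eq_zero_of_index_le_one A hi (hw i), map_zero, map_zero, mul_zero]
  let s : ℕ → ℝ := fun n => (r ^ n)⁻¹ * ∑ j, (b j : ℝ) * (body A)^[n] x j
  have hs : ∀ n, (s n : ℂ) = ∑ i : spectralIndex A r, ∑ k ∈ Finset.range d,
      orbitCoeff A b i (w i) k * (n.choose k : ℂ) * ((i : ℂ) / r) ^ n := by
    intro n
    rw [Complex.ofReal_mul, ofReal_guard_iterate, ← hsum, guardForm_pow_eq A b hr hw,
      Complex.ofReal_inv, Complex.ofReal_pow, inv_mul_cancel_left₀ (pow_ne_zero n hr0)]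
  have hsign : (∀ᶠ n in atTop, 0 ≤ ∑ j, (b j : ℝ) * (body A)^[n] x j) ↔
      ∀ᶠ n in atTop, 0 ≤ s n :=
    eventually_congr (Eventually.of_forall fun n =>
      (mul_nonneg_iff_of_pos_left (inv_pos.2 (pow_pos hr n))).symm)
  rw [mem_ENT_iff, hsign]
  refine eventually_nonneg_iff (ζ := fun i : spectralIndex A r => (i : ℂ) / r)
    (fun i j hij => Subtype.ext ((div_left_inj' hr0).1 hij)) (fun i => ?_)
    ⟨r, (mem_spectralIndex A).2 (Or.inl rfl)⟩ (div_self hr0) hd (fun k hk => ?_) hs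
  · rw [norm_div, norm_of_mem_spectralIndex A hr.le, Complex.norm_of_nonneg hr.le, div_self hr.ne']
  · refine hindex.imp (fun h => hsimple _ h k hk) fun h i hi => hsimple i ?_ k hk
    have hir : (i : ℂ) ≠ r := fun h => hi (Subtype.ext h)
    exact h i (((mem_spectralIndex A).1 i.2).resolve_left hir) hir

theorem isSemialgebraic_ENT_inter_modulusSubspace {r : ℝ} (hr : r ∈ eigenvalueModuli A)
    (hr0 : 0 < r) (hd : 0 < d)
    (hindex : index A r ≤ 1 ∨ ∀ z ∈ modulusClass A r, z ≠ r → index A z ≤ 1) :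
    IsSemialgebraic (ENT (body A) (guard b) ∩ (modulusSubspace A r : Set (Fin d → ℝ))) := by
  have hcoeff : ∀ (i : spectralIndex A r) (k : ℕ), IsComplexAlgPolynomial
      fun v : Fin d ⊕ (spectralIndex A r × Fin d × Bool) → ℝ =>
        orbitCoeff A b i (vectorFamily v i) k := fun i k => by
    have hi := isAlgebraic_of_mem_spectralIndex A hr i
    exact (IsComplexAlgPolynomial.const (hi.pow k).inv).mul
      (isComplexAlgPolynomial_guardForm b fun j =>
        isComplexAlgPolynomial_pow_apply A (fun j => .mk_coord _ _) hi k j)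
  have hzero : ∀ (i : spectralIndex A r) (k : ℕ), SignDetermined
      {v : Fin d ⊕ (spectralIndex A r × Fin d × Bool) → ℝ |
        orbitCoeff A b i (vectorFamily v i) k = 0} := fun i k =>
    IsComplexAlgPolynomial.signDetermined_eq (hcoeff i k) (.const isAlgebraic_zero)
  have hζ : ∀ i : spectralIndex A r, (i : ℂ) / r ≠ 0 := fun i h => by
    have h1 := norm_of_mem_spectralIndex A hr0.le i
    rcases div_eq_zero_iff.1 h with h | h
    · rw [h, norm_zero] at h1
      exact hr0.ne h1
    · exact hr0.ne' (Complex.ofReal_eq_zero.1 h)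
  have hP : SignDetermined {v : Fin d ⊕ (spectralIndex A r × Fin d × Bool) → ℝ |
      EventuallyGuarded A b r (vectorFamily v)} := by
    refine SignDetermined.or (.exists_finite fun k : Fin d => (SignDetermined.const _).and
      ((SignDetermined.forall_finite fun j : Fin d => (SignDetermined.const _).imp
        (.forall_finite fun i => hzero i j)).and
          (hcoeff ⟨r, (mem_spectralIndex A).2 (Or.inl rfl)⟩ k).re.signDetermined_pos))
      ((SignDetermined.forall_finite fun j : Fin d => (SignDetermined.const _).imp
        (.forall_finite fun i => hzero i j)).and ?_)
    exact signDetermined_torus_nonneg hζ fun i => hcoeff i 0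
  convert (signDetermined_exists_decomposition A hr _ hP).isSemialgebraic using 1
  ext x
  rw [Set.mem_inter_iff, SetLike.mem_coe, mem_modulusSubspace_iff A hr0.le]
  constructor
  · rintro ⟨hx, w, hw, hsum⟩
    exact ⟨w, ⟨hw, hsum⟩, (mem_ENT_iff_eventuallyGuarded A b hr0 hd hindex hw hsum).1 hx⟩
  · rintro ⟨w, ⟨hw, hsum⟩, hPw⟩
    exact ⟨(mem_ENT_iff_eventuallyGuarded A b hr0 hd hindex hw hsum).2 hPw, w, hw, hsum⟩

end LinearLoop

theorem mainTheorem4 (d : ℕ) (A : Matrix (Fin d) (Fin d) ℤ) (b : Fin d → ℤ)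
    (hA : LinearLoop.NonDegenerate A)
    (r : ℝ) (hr : r ∈ LinearLoop.eigenvalueModuli A)
    (hcases : d ≤ 5 ∨
      (∀ ρ : ℝ, 0 < ρ → (ρ : ℂ) ∉ LinearLoop.modulusClass A r) ∨
      (∀ z ∈ LinearLoop.modulusClass A r, z.im ≠ 0 → LinearLoop.index A z = 1)) :
    LinearLoop.IsSemialgebraic
      (LinearLoop.ENT (LinearLoop.body A) (LinearLoop.guard b) ∩
        (LinearLoop.modulusSubspace A r : Set (Fin d → ℝ))) := by
  have hr0 : 0 ≤ r := by
    obtain ⟨z, -, rfl⟩ := hr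
    exact norm_nonneg z
  -- An eigenvalue has positive index and indices sum to at most `d`. Positivity ensures that level
  -- `k = 0` lies in the range of summation.
  have hd : 0 < d := by
    obtain ⟨z, hz, -⟩ := hr
    exact ((LinearLoop.index_pos_iff A z).2 hz).trans_le
      (by simpa using LinearLoop.sum_index_le A {z})
  rcases hr0.eq_or_lt with rfl | hpos
  · rw [Set.inter_eq_right.2 (LinearLoop.modulusSubspace_zero_subset_ENT A b)]
    exact LinearLoop.isSemialgebraic_modulusSubspace A hr le_rfl
  · exact LinearLoop.isSemialgebraic_ENT_inter_modulusSubspace A b hr hpos hd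
      (LinearLoop.index_le_one_or A hpos hA hcases)
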